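/- Let $\mathfrak g$ be a finite-dimensional complex simple Lie algebra with Cartan subalgebra $\mathfrak h$, root system $R$, a fixed set of simple roots $\{\alpha_i\}_{i\in I}$ with corresponding simple coroots $h_i\in\mathfrak h$, positive roots $R^+$ and dominant integral weights $P^+$; let $(\cdot,\cdot)$ be the form on $\mathfrak h^*$ induced by the Killing form. For $\mu\in P^+$ let $V(\mu)$ be the simple $\mathfrak g$-module of highest weight $\mu$, that is, the $\mathfrak g$-module generated by $v_\mu$ with defining relations $hv_\mu=\mu(h)v_\mu$ for $h\in\mathfrak h$, $\mathfrak g_{\alpha_i}v_\mu=0$ and $y^{\mu(h_i)+1}v_\mu=0$ for $y\in\mathfrak g_{-\alpha_i}$, $i\in I$. Let $\mathfrak g\ltimes\mathfrak g_{\rm ad}$ be the Lie algebra $\mathfrak g\oplus\mathfrak g$ with bracket $[(x,y),(x',y')]=([x,x'],[x,y']+[y,x'])$, graded by giving $\mathfrak g=\{(x,0)\}$ degree $0$ and $\mathfrak g_{\rm ad}=\{(0,y)\}$ degree $1$. Let $\mathcal G_2$ be the category of graded modules $V=\bigoplus_{k\ge 0}V[k]$ over $\mathfrak g\ltimes\mathfrak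 g_{\rm ad}$ (that is, $\mathfrak g V[k]\subset V[k]$ and $\mathfrak g_{\rm ad}V[k]\subset V[k+1]$) with all $V[k]$ finite-dimensional, with grading-preserving module homomorphisms as morphisms. Let $\tau_r$ be the grading shift by $r\ge 0$: $(\tau_rV)[k]=V[k-r]$ for $k\ge r$ and $(\tau_rV)[k]=0$ for $k<r$. For a subset $\Gamma\subset P^+\times\mathbb Z_{\ge0}$, let $\mathcal G_2[\Gamma]$ be the full subcategory of those $V$ in $\mathcal G_2$ such that $\operatorname{Hom}_{\mathfrak g}(V(\nu),V[s])\ne0$ implies $(\nu,s)\in\Gamma$, and for $V$ in $\mathcal G_2$ let $V^\Gamma$ be the maximal quotient of $V$ (by a graded submodule) that lies in $\mathcal G_2[\Gamma]$. Let $P(\mu,r)=U(\mathfrak g\ltimes\mathfrak g_{\rm ad})\otimes_{U(\mathfrak g)}V(\mu)$ with $V(\mu)$ placed in degree $r$. For $\lambda\in P^+$ and $S\subset R$ put $$\Gamma(\lambda,S)=\Big\{(\mu,r)\in P^+\times\mathbb Z_{\ge0}\ :\ \mu=\lambda-\sum_{\beta\in S}n_\beta\beta,\ \ \sum_{\beta\in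 S}n_\beta=r\ \text{ for some } n_\beta\in\mathbb Z_{\ge0}\Big\}.$$ Let $\Psi\subset R^+$ be such that $\Psi=\{\alpha\in R:(\alpha,\xi)=\max_{\beta\in R}(\beta,\xi)\}$ for some $\xi\in P^+$, let $\lambda\in P^+$, put $\Gamma=\Gamma(\lambda,\Psi)$, and let $(\mu,r)\in\Gamma$. Then the maximal quotients $P(\mu,r)^\Gamma$ and $P(\mu,0)^{\Gamma(\mu,\Psi)}$ are well defined, that is, the quotient of $P(\mu,r)$ (respectively $P(\mu,0)$) by the intersection of all graded submodules with quotient in $\mathcal G_2[\Gamma]$ (respectively $\mathcal G_2[\Gamma(\mu,\Psi)]$) lies again in that subcategory, and there is an isomorphism in $\mathcal G_2$ $$\tau_r\,P(\mu,0)^{\Gamma(\mu,\Psi)}\;\cong\;P(\mu,r)^{\Gamma}.$$ -/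

import Mathlib

open CategoryTheory TensorProduct

universe u

set_option linter.unusedSectionVars false

noncomputable section

/-! ### The Lie algebra `𝔤 ⋉ 𝔤_ad` -/

/-- The Lie algebra `𝔤 ⋉ 𝔤_ad`: the vector space `𝔤 ⊕ 𝔤` with the bracket
`[(x, y), (x', y')] = ([x, x'], [x, y'] + [y, x'])`. -/
@[ext] structure AdExt (𝔤 : Type u) : Type u where
  fst : 𝔤
  snd : 𝔤

namespace AdExt

/-- As a set, `𝔤 ⋉ 𝔤_ad` is `𝔤 × 𝔤`. -/
def toProd {𝔤 : Type u} : AdExt 𝔤 ≃ 𝔤 × 𝔤 where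
  toFun p := (p.fst, p.snd)
  invFun p := ⟨p.1, p.2⟩

variable {𝔤 : Type u} [LieRing 𝔤]

instance : AddCommGroup (AdExt 𝔤) := toProd.addCommGroup

instance : Bracket (AdExt 𝔤) (AdExt 𝔤) where
  bracket p q := ⟨⁅p.fst, q.fst⁆, ⁅p.fst, q.snd⁆ + ⁅p.snd, q.fst⁆⟩

@[simp] theorem add_fst (p q : AdExt 𝔤) : (p + q).fst = p.fst + q.fst := rfl
@[simp] theorem add_snd (p q : AdExt 𝔤) : (p + q).snd = p.snd + q.snd := rfl
@[simp] theorem zero_fst : (0 : AdExt 𝔤).fst = 0 := rfl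
@[simp] theorem zero_snd : (0 : AdExt 𝔤).snd = 0 := rfl
@[simp] theorem lie_fst (p q : AdExt 𝔤) : ⁅p, q⁆.fst = ⁅p.fst, q.fst⁆ := rfl
@[simp] theorem lie_snd (p q : AdExt 𝔤) :
    ⁅p, q⁆.snd = ⁅p.fst, q.snd⁆ + ⁅p.snd, q.fst⁆ := rfl

instance : LieRing (AdExt 𝔤) where
  add_lie p q s := by ext <;> simp; abel
  lie_add p q s := by ext <;> simp; abel
  lie_self p := by
    ext
    · simp
    · rw [lie_snd, ← lie_skew p.fst p.snd, neg_add_cancel, zero_snd]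
  leibniz_lie p q s := by
    ext
    · simp
    · simp only [lie_snd, lie_fst, add_snd, lie_add, add_lie]
      rw [leibniz_lie p.fst q.fst s.snd, leibniz_lie p.fst q.snd s.fst,
        leibniz_lie p.snd q.fst s.fst]
      abel

variable [LieAlgebra ℂ 𝔤]

instance : Module ℂ (AdExt 𝔤) := toProd.module ℂ

@[simp] theorem smul_fst (c : ℂ) (p : AdExt 𝔤) : (c • p).fst = c • p.fst := rfl
@[simp] theorem smul_snd (c : ℂ) (p : AdExt 𝔤) : (c • p).snd = c • p.snd := rfl

instance : LieAlgebra ℂ (AdExt 𝔤) where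
  lie_smul c p q := by ext <;> simp

/-- The inclusion `x ↦ (x, 0)` of `𝔤` into `𝔤 ⋉ 𝔤_ad`. -/
def inl : 𝔤 →ₗ⁅ℂ⁆ AdExt 𝔤 where
  toFun x := ⟨x, 0⟩
  map_add' _ _ := by ext <;> simp
  map_smul' _ _ := by ext <;> simp
  map_lie' := by intros; ext <;> simp

/-- The inclusion `x ↦ (x)_ad = (0, x)` of `𝔤_ad` into `𝔤 ⋉ 𝔤_ad`. -/
def ad : 𝔤 →ₗ[ℂ] AdExt 𝔤 where
  toFun x := ⟨0, x⟩
  map_add' _ _ := by ext <;> simp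
  map_smul' _ _ := by ext <;> simp

/-- The endomorphism `(x, y) ↦ (x, 2 y)` of the Lie algebra `𝔤 ⋉ 𝔤_ad`; it multiplies elements of
degree `k` of the enveloping algebra by `2 ^ k`, and serves to separate degrees. -/
def dilate : AdExt 𝔤 →ₗ⁅ℂ⁆ AdExt 𝔤 where
  toFun p := ⟨p.fst, (2 : ℂ) • p.snd⟩
  map_add' _ _ := by ext <;> simp
  map_smul' c p := by
    ext
    · simp
    · exact smul_comm (2 : ℂ) c p.snd
  map_lie' := by intros; ext <;> simp

theorem eq_inl_add_ad (p : AdExt 𝔤) : p = inl p.fst + ad p.snd := by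
  ext
  · exact (add_zero p.fst).symm
  · exact (zero_add p.snd).symm

theorem dilate_inl (x : 𝔤) : dilate (inl x) = inl x := by
  ext
  · rfl
  · exact smul_zero (2 : ℂ)

theorem dilate_ad (x : 𝔤) : dilate (ad x) = (2 : ℂ) • ad x := by
  ext
  · exact (smul_zero (2 : ℂ)).symm
  · rfl

end AdExt

/-! ### The category of graded modules -/

section GradedModules

variable (𝔤 : Type u) [LieRing 𝔤] [LieAlgebra ℂ 𝔤]

/-- A graded `𝔤 ⋉ 𝔤_ad`-module `V = ⨁_{k ≥ 0} V[k]` with `𝔤 V[k] ⊆ V[k]` and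
`𝔤_ad V[k] ⊆ V[k + 1]`; the graded pieces may have infinite dimension. -/
structure GradedLieMod where
  carrier : Type u
  [addCommGroup : AddCommGroup carrier]
  [module : Module ℂ carrier]
  [lieRingModule : LieRingModule (AdExt 𝔤) carrier]
  [lieModule : LieModule ℂ (AdExt 𝔤) carrier]
  /-- The graded pieces `V[k]`. -/
  gr : ℕ → Submodule ℂ carrier
  isInternal : DirectSum.IsInternal gr
  inl_lie_mem : ∀ (x : 𝔤) (k : ℕ) (v : carrier), v ∈ gr k → ⁅AdExt.inl x, v⁆ ∈ gr k
  ad_lie_mem : ∀ (x : 𝔤) (k : ℕ) (v : carrier), v ∈ gr k → ⁅AdExt.ad x, v⁆ ∈ gr (k + 1)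

namespace GradedLieMod

attribute [instance] addCommGroup module lieRingModule lieModule

variable {𝔤}

/-- Morphisms: homomorphisms of `𝔤 ⋉ 𝔤_ad`-modules that preserve the grading. -/
@[ext] structure Hom (V W : GradedLieMod 𝔤) where
  toLieModuleHom : V.carrier →ₗ⁅ℂ, AdExt 𝔤⁆ W.carrier
  map_mem : ∀ (k : ℕ) (v : V.carrier), v ∈ V.gr k → toLieModuleHom v ∈ W.gr k

instance : Category (GradedLieMod 𝔤) where
  Hom := Hom
  id V := ⟨LieModuleHom.id, fun _ _ hv ↦ hv⟩
  comp f g := ⟨g.toLieModuleHom.comp f.toLieModuleHom,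
    fun k v hv ↦ g.map_mem k _ (f.map_mem k v hv)⟩

/-- Each graded piece `V[k]` is a `𝔤`-module. -/
instance (V : GradedLieMod 𝔤) (k : ℕ) : LieRingModule 𝔤 (V.gr k) where
  bracket x v := ⟨⁅AdExt.inl x, (v : V.carrier)⁆, V.inl_lie_mem x k v v.2⟩
  add_lie x y v := Subtype.ext (by simp)
  lie_add x v w := Subtype.ext (by simp)
  leibniz_lie x y v := Subtype.ext (by simp)

instance (V : GradedLieMod 𝔤) (k : ℕ) : LieModule ℂ 𝔤 (V.gr k) where
  smul_lie c x v := Subtype.ext (by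
    change ⁅AdExt.inl (c • x), (v : V.carrier)⁆ = c • ⁅AdExt.inl x, (v : V.carrier)⁆
    simp)
  lie_smul c x v := Subtype.ext (by
    change ⁅AdExt.inl x, c • (v : V.carrier)⁆ = c • ⁅AdExt.inl x, (v : V.carrier)⁆
    simp)

/-- The objects of `𝒢₂` are the graded modules with finite-dimensional graded pieces. -/
def G2 : ObjectProperty (GradedLieMod 𝔤) := fun V ↦ ∀ k, FiniteDimensional ℂ (V.gr k)

/-! #### Grading shift -/

theorem isInternal_shift {M : Type u} [AddCommGroup M] [Module ℂ M] {gr : ℕ → Submodule ℂ M}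
    (h : DirectSum.IsInternal gr) (r : ℕ) :
    DirectSum.IsInternal (fun k ↦ if r ≤ k then gr (k - r) else ⊥) := by
  rw [DirectSum.isInternal_submodule_iff_iSupIndep_and_iSup_eq_top] at h ⊢
  refine ⟨?_, ?_⟩
  · rw [iSupIndep_def] at *
    intro i
    by_cases hi : r ≤ i
    · simp only [hi, if_true]
      refine (h.1 (i - r)).mono_right (iSup₂_le fun j hj ↦ ?_)
      by_cases hj' : r ≤ j
      · simp only [hj', if_true]
        exact le_iSup₂_of_le (j - r) (by omega) le_rfl
      · simp [hj']
    · simp [hi]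
  · rw [eq_top_iff, ← h.2]
    refine iSup_le fun k ↦ le_iSup_of_le (k + r) ?_
    simp

/-- The grading shift `τ_r`: the same module, with `(τ_r V)[k] = V[k - r]` for `k ≥ r` and
`(τ_r V)[k] = 0` for `k < r`. -/
def shiftObj (r : ℕ) (V : GradedLieMod 𝔤) : GradedLieMod 𝔤 where
  carrier := V.carrier
  gr k := if r ≤ k then V.gr (k - r) else ⊥
  isInternal := isInternal_shift V.isInternal r
  inl_lie_mem x k v hv := by
    by_cases hk : r ≤ k
    · simp only [hk, if_true] at hv ⊢
      exact V.inl_lie_mem x _ v hv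
    · simp only [hk, if_false, Submodule.mem_bot] at hv ⊢
      simp [hv]
  ad_lie_mem x k v hv := by
    by_cases hk : r ≤ k
    · have hk' : r ≤ k + 1 := by omega
      simp only [hk, hk', if_true] at hv ⊢
      have := V.ad_lie_mem x _ v hv
      rwa [show k + 1 - r = k - r + 1 by omega]
    · simp only [hk, if_false, Submodule.mem_bot] at hv
      simp [hv]

/-- The grading shift functor `τ_r`. -/
def shift (r : ℕ) : GradedLieMod 𝔤 ⥤ GradedLieMod 𝔤 where
  obj := shiftObj r
  map {V W} f := ⟨f.toLieModuleHom, fun k v hv ↦ by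
    by_cases hk : r ≤ k
    · simp only [shiftObj, hk, if_true] at hv ⊢
      exact f.map_mem _ v hv
    · simp only [shiftObj, hk, if_false] at hv ⊢
      subst hv
      exact map_zero f.toLieModuleHom⟩

/-! #### Graded submodules and quotients -/

/-- The projection of `V` onto its graded piece `V[k]`, as an endomorphism of `V`. -/
def proj (V : GradedLieMod 𝔤) (k : ℕ) (v : V.carrier) : V.carrier :=
  letI := V.isInternal.chooseDecomposition
  (DirectSum.decompose V.gr v k : V.carrier)

theorem proj_add (V : GradedLieMod 𝔤) (k : ℕ) (v w : V.carrier) :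
    V.proj k (v + w) = V.proj k v + V.proj k w := by
  simp [proj, DirectSum.decompose_add]

theorem proj_of_mem (V : GradedLieMod 𝔤) {k : ℕ} {v : V.carrier} (hv : v ∈ V.gr k) :
    V.proj k v = v := by
  let := V.isInternal.chooseDecomposition
  exact DirectSum.decompose_of_mem_same V.gr hv

theorem proj_of_mem_ne (V : GradedLieMod 𝔤) {k l : ℕ} {v : V.carrier} (hv : v ∈ V.gr k)
    (h : k ≠ l) : V.proj l v = 0 := by
  let := V.isInternal.chooseDecomposition
  exact DirectSum.decompose_of_mem_ne V.gr hv h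

/-- A `𝔤 ⋉ 𝔤_ad`-submodule is graded if it contains the homogeneous components of its elements. -/
def IsGraded (V : GradedLieMod 𝔤) (K : LieSubmodule ℂ (AdExt 𝔤) V.carrier) : Prop :=
  ∀ v ∈ K, ∀ k, V.proj k v ∈ K

theorem isGraded_sInf (V : GradedLieMod 𝔤) (S : Set (LieSubmodule ℂ (AdExt 𝔤) V.carrier))
    (hS : ∀ K ∈ S, V.IsGraded K) : V.IsGraded (sInf S) := by
  intro v hv k
  rw [← SetLike.mem_coe, LieSubmodule.coe_sInf, Set.mem_iInter₂] at hv ⊢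
  exact fun K hK ↦ hS K hK v (hv K hK) k

theorem isInternal_quotient (V : GradedLieMod 𝔤) (K : LieSubmodule ℂ (AdExt 𝔤) V.carrier)
    (hK : V.IsGraded K) : DirectSum.IsInternal
      (fun k ↦ (V.gr k).map (LieSubmodule.Quotient.mk' K : V.carrier →ₗ[ℂ] V.carrier ⧸ K)) := by
  have hV := V.isInternal
  rw [DirectSum.isInternal_submodule_iff_iSupIndep_and_iSup_eq_top] at hV ⊢
  refine ⟨?_, ?_⟩
  · rw [iSupIndep_def]
    intro i
    rw [Submodule.disjoint_def]
    rintro x ⟨v, hv, rfl⟩ hx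
    simp only [← Submodule.map_iSup] at hx
    obtain ⟨w, hw, hwv⟩ := hx
    have h0 : V.proj i w = 0 := by
      refine Submodule.iSup_induction (fun j : ℕ ↦ ⨆ (_ : j ≠ i), V.gr j)
        (motive := fun w ↦ V.proj i w = 0) hw ?_ ?_ ?_
      · intro j x hx
        by_cases hj : j = i
        · have : x = 0 := by simpa [hj] using hx
          subst this
          exact V.proj_of_mem_ne (k := i + 1) (Submodule.zero_mem _) (by omega)
        · exact V.proj_of_mem_ne (k := j) (by simpa [hj] using hx) hj
      · exact V.proj_of_mem_ne (k := i + 1) (Submodule.zero_mem _) (by omega)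
      · intro x y hx hy
        rw [proj_add, hx, hy, add_zero]
    have hmem : v - w ∈ K := by
      have : (LieSubmodule.Quotient.mk (v - w) : V.carrier ⧸ K) = 0 := by
        have h := hwv.symm
        exact (map_sub (LieSubmodule.Quotient.mk' K) v w).trans (sub_eq_zero.mpr h)
      exact (LieSubmodule.Quotient.mk_eq_zero').mp this
    have h1 := hK _ hmem i
    have h2 : V.proj i (v - w) + V.proj i w = V.proj i v := by
      rw [← proj_add, sub_add_cancel]
    rw [h0, add_zero, V.proj_of_mem hv] at h2
    rw [h2] at h1
    exact (LieSubmodule.Quotient.mk_eq_zero').mpr h1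
  · rw [← Submodule.map_iSup, hV.2, Submodule.map_top]
    exact LinearMap.range_eq_top.mpr (LieSubmodule.Quotient.surjective_mk' K)

/-- The quotient of a graded module by a graded submodule, with `(V/K)[k]` the image of `V[k]`. -/
def quotient (V : GradedLieMod 𝔤) (K : LieSubmodule ℂ (AdExt 𝔤) V.carrier)
    (hK : V.IsGraded K) : GradedLieMod 𝔤 where
  carrier := V.carrier ⧸ K
  gr k := (V.gr k).map (LieSubmodule.Quotient.mk' K : V.carrier →ₗ[ℂ] V.carrier ⧸ K)
  isInternal := V.isInternal_quotient K hK
  inl_lie_mem := by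
    rintro x k _ ⟨v, hv, rfl⟩
    exact ⟨_, V.inl_lie_mem x k v hv, LieModuleHom.map_lie (LieSubmodule.Quotient.mk' K) _ _⟩
  ad_lie_mem := by
    rintro x k _ ⟨v, hv, rfl⟩
    exact ⟨_, V.ad_lie_mem x k v hv, LieModuleHom.map_lie (LieSubmodule.Quotient.mk' K) _ _⟩

end GradedLieMod

end GradedModules

/-! ### Modules over enveloping algebras and induced modules -/

/-- The universal enveloping algebra over `ℂ`. -/
abbrev UEnv (L : Type u) [LieRing L] [LieAlgebra ℂ L] : Type u := UniversalEnvelopingAlgebra ℂ L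

namespace UEnv

section

attribute [local instance 100] LieRing.ofAssociativeRing

variable {L : Type u} [LieRing L] [LieAlgebra ℂ L]

/-- The canonical map of a Lie algebra to its enveloping algebra. -/
def ι : L →ₗ[ℂ] UEnv L := (UniversalEnvelopingAlgebra.ι ℂ : L →ₗ⁅ℂ⁆ UEnv L).toLinearMap

theorem ι_lie (x y : L) : ι ⁅x, y⁆ = ι x * ι y - ι y * ι x :=
  (LieHom.map_lie (UniversalEnvelopingAlgebra.ι ℂ : L →ₗ⁅ℂ⁆ UEnv L) x y).trans
    (LieRing.of_associative_ring_bracket _ _)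

/-- The homomorphism of enveloping algebras induced by a homomorphism of Lie algebras. -/
def map {L' : Type u} [LieRing L'] [LieAlgebra ℂ L'] (f : L →ₗ⁅ℂ⁆ L') : UEnv L →ₐ[ℂ] UEnv L' :=
  UniversalEnvelopingAlgebra.lift ℂ ((UniversalEnvelopingAlgebra.ι ℂ : L' →ₗ⁅ℂ⁆ UEnv L').comp f)

theorem map_ι {L' : Type u} [LieRing L'] [LieAlgebra ℂ L'] (f : L →ₗ⁅ℂ⁆ L') (x : L) :
    map f (ι x) = ι (f x) :=
  UniversalEnvelopingAlgebra.lift_ι_apply ℂ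
    ((UniversalEnvelopingAlgebra.ι ℂ : L' →ₗ⁅ℂ⁆ UEnv L').comp f) x

/-- A subspace of the enveloping algebra that contains `1` and is stable under left multiplication
by the Lie algebra is everything. -/
theorem eq_top_of_one_mem (S : Submodule ℂ (UEnv L)) (h1 : 1 ∈ S)
    (hS : ∀ (x : L), ∀ u ∈ S, ι x * u ∈ S) : S = ⊤ := by
  let T : Subalgebra ℂ (UEnv L) :=
    { carrier := {u | ∀ s ∈ S, u * s ∈ S}
      mul_mem' := fun {a b} ha hb s hs ↦ by rw [mul_assoc]; exact ha _ (hb s hs)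
      add_mem' := fun {a b} ha hb s hs ↦ by rw [add_mul]; exact S.add_mem (ha s hs) (hb s hs)
      algebraMap_mem' := fun c s hs ↦ by
        rw [← Algebra.smul_def]
        exact S.smul_mem c hs }
  let f : L →ₗ⁅ℂ⁆ T :=
    { toFun := fun x ↦ ⟨ι x, hS x⟩
      map_add' := fun x y ↦ Subtype.ext (map_add ι x y)
      map_smul' := fun c x ↦ Subtype.ext (map_smul ι c x)
      map_lie' := fun {x y} ↦ Subtype.ext (ι_lie x y) }
  have key : T.val.comp (UniversalEnvelopingAlgebra.lift ℂ f) = AlgHom.id ℂ (UEnv L) := by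
    apply UniversalEnvelopingAlgebra.hom_ext
    ext x
    change ((UniversalEnvelopingAlgebra.lift ℂ f (UniversalEnvelopingAlgebra.ι ℂ x) : T) : UEnv L)
      = UniversalEnvelopingAlgebra.ι ℂ x
    rw [UniversalEnvelopingAlgebra.lift_ι_apply]
    rfl
  rw [eq_top_iff]
  intro u _
  have hu : u ∈ T := by
    have := DFunLike.congr_fun key u
    rw [← show _ = u from this]
    exact (UniversalEnvelopingAlgebra.lift ℂ f u).2
  simpa using hu 1 h1

end

variable {L : Type u} [LieRing L] [LieAlgebra ℂ L]

/-- A module over the enveloping algebra is a module over the Lie algebra. -/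
abbrev lieRingModule (M : Type u) [AddCommGroup M] [Module (UEnv L) M] : LieRingModule L M where
  bracket x m := ι x • m
  add_lie x y m := by
    rw [map_add, add_smul]
  lie_add x m n := smul_add _ _ _
  leibniz_lie x y m := by
    change ι x • ι y • m = ι ⁅x, y⁆ • m + ι y • ι x • m
    rw [ι_lie, sub_smul, mul_smul, mul_smul, sub_add_cancel]

theorem lieModule (M : Type u) [AddCommGroup M] [Module ℂ M] [Module (UEnv L) M]
    [IsScalarTower ℂ (UEnv L) M] : letI := lieRingModule (L := L) M; LieModule ℂ L M :=
  letI := lieRingModule (L := L) M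
  { smul_lie := fun c x m ↦ by
      change ι (c • x) • m = c • ι x • m
      rw [map_smul, smul_assoc]
    lie_smul := fun c x m ↦ by
      change ι x • c • m = c • ι x • m
      rw [← algebraMap_smul (UEnv L) c m, ← algebraMap_smul (UEnv L) c (ι x • m),
        ← mul_smul, ← mul_smul, Algebra.commutes] }

end UEnv

section Induced

variable {𝔤 : Type u} [LieRing 𝔤] [LieAlgebra ℂ 𝔤]

/-- Products of elements of `𝔤` and `𝔤_ad` in `U(𝔤 ⋉ 𝔤_ad)` with exactly `k` factors
from `𝔤_ad`. -/
inductive IsMonomial : ℕ → UEnv (AdExt 𝔤) → Prop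
  | one : IsMonomial 0 1
  | inl_mul (x : 𝔤) {k : ℕ} {u : UEnv (AdExt 𝔤)} :
      IsMonomial k u → IsMonomial k (UEnv.ι (AdExt.inl x) * u)
  | ad_mul (x : 𝔤) {k : ℕ} {u : UEnv (AdExt 𝔤)} :
      IsMonomial k u → IsMonomial (k + 1) (UEnv.ι (AdExt.ad x) * u)

variable (V : Type u) [AddCommGroup V] [Module ℂ V] [Module (UEnv 𝔤) V]
  [IsScalarTower ℂ (UEnv 𝔤) V]

/-- The relations `(u a) ⊗ v = u ⊗ (a v)`, `a ∈ U(𝔤)`, of the tensor product over `U(𝔤)`. -/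
def balancedRel : Submodule (UEnv (AdExt 𝔤)) (UEnv (AdExt 𝔤) ⊗[ℂ] V) :=
  Submodule.span _ {t | ∃ (u : UEnv (AdExt 𝔤)) (a : UEnv 𝔤) (v : V),
    t = (u * UEnv.map AdExt.inl a) ⊗ₜ[ℂ] v - u ⊗ₜ[ℂ] (a • v)}

/-- The induced module `U(𝔤 ⋉ 𝔤_ad) ⊗_{U(𝔤)} V`. -/
def Induced : Type u := (UEnv (AdExt 𝔤) ⊗[ℂ] V) ⧸ balancedRel V

namespace Induced

instance : AddCommGroup (Induced (𝔤 := 𝔤) V) :=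
  inferInstanceAs (AddCommGroup ((UEnv (AdExt 𝔤) ⊗[ℂ] V) ⧸ balancedRel V))

instance : Module (UEnv (AdExt 𝔤)) (Induced (𝔤 := 𝔤) V) :=
  inferInstanceAs (Module (UEnv (AdExt 𝔤)) ((UEnv (AdExt 𝔤) ⊗[ℂ] V) ⧸ balancedRel V))

instance : Module ℂ (Induced (𝔤 := 𝔤) V) :=
  inferInstanceAs (Module ℂ ((UEnv (AdExt 𝔤) ⊗[ℂ] V) ⧸ balancedRel V))

instance : IsScalarTower ℂ (UEnv (AdExt 𝔤)) (Induced (𝔤 := 𝔤) V) :=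
  inferInstanceAs (IsScalarTower ℂ (UEnv (AdExt 𝔤)) ((UEnv (AdExt 𝔤) ⊗[ℂ] V) ⧸ balancedRel V))

instance : LieRingModule (AdExt 𝔤) (Induced (𝔤 := 𝔤) V) := UEnv.lieRingModule _

instance : LieModule ℂ (AdExt 𝔤) (Induced (𝔤 := 𝔤) V) := UEnv.lieModule _

variable {V}

/-- The class of `u ⊗ v` in `U(𝔤 ⋉ 𝔤_ad) ⊗_{U(𝔤)} V`. -/
def tmul (u : UEnv (AdExt 𝔤)) (v : V) : Induced (𝔤 := 𝔤) V :=
  (balancedRel (𝔤 := 𝔤) V).mkQ (u ⊗ₜ[ℂ] v)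

theorem smul_tmul (w u : UEnv (AdExt 𝔤)) (v : V) : w • tmul u v = tmul (w * u) v := rfl

theorem lie_tmul (x : AdExt 𝔤) (u : UEnv (AdExt 𝔤)) (v : V) :
    ⁅x, tmul u v⁆ = tmul (UEnv.ι x * u) v := rfl

variable (V)

/-- The linear map `u ⊗ v ↦ tmul u v`. -/
def tmulₗ : UEnv (AdExt 𝔤) ⊗[ℂ] V →ₗ[ℂ] Induced (𝔤 := 𝔤) V :=
  ((balancedRel (𝔤 := 𝔤) V).mkQ).restrictScalars ℂ

theorem tmulₗ_surjective : Function.Surjective (tmulₗ (𝔤 := 𝔤) V) :=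
  (balancedRel (𝔤 := 𝔤) V).mkQ_surjective

/-- The degree `k` part of the induced module when `V` is placed in degree `r`. -/
def piece (r k : ℕ) : Submodule ℂ (Induced (𝔤 := 𝔤) V) :=
  Submodule.span ℂ {t | ∃ (a : ℕ) (u : UEnv (AdExt 𝔤)) (v : V),
    r + a = k ∧ IsMonomial a u ∧ t = tmul u v}

theorem inl_lie_mem (r : ℕ) (x : 𝔤) (k : ℕ) (t : Induced (𝔤 := 𝔤) V) (ht : t ∈ piece V r k) :
    ⁅AdExt.inl x, t⁆ ∈ piece V r k := by
  induction ht using Submodule.span_induction with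
  | mem t ht =>
    obtain ⟨a, u, v, h, hu, rfl⟩ := ht
    exact Submodule.subset_span ⟨a, _, v, h, hu.inl_mul x, lie_tmul _ _ _⟩
  | zero => simp
  | add s t _ _ hs ht => rw [lie_add]; exact add_mem hs ht
  | smul c t _ ht => rw [lie_smul]; exact Submodule.smul_mem _ c ht

theorem ad_lie_mem (r : ℕ) (x : 𝔤) (k : ℕ) (t : Induced (𝔤 := 𝔤) V) (ht : t ∈ piece V r k) :
    ⁅AdExt.ad x, t⁆ ∈ piece V r (k + 1) := by
  induction ht using Submodule.span_induction with
  | mem t ht =>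
    obtain ⟨a, u, v, h, hu, rfl⟩ := ht
    exact Submodule.subset_span ⟨a + 1, _, v, by omega, hu.ad_mul x, lie_tmul _ _ _⟩
  | zero => simp
  | add s t _ _ hs ht => rw [lie_add]; exact add_mem hs ht
  | smul c t _ ht => rw [lie_smul]; exact Submodule.smul_mem _ c ht

theorem iSup_piece (r : ℕ) : ⨆ k, piece (𝔤 := 𝔤) V r k = ⊤ := by
  set N := ⨆ k, piece (𝔤 := 𝔤) V r k with hN
  have hlie : ∀ (x : AdExt 𝔤), ∀ t ∈ N, ⁅x, t⁆ ∈ N := by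
    intro x t ht
    refine Submodule.iSup_induction (fun k ↦ piece (𝔤 := 𝔤) V r k)
      (motive := fun t ↦ ⁅x, t⁆ ∈ N) ht ?_ ?_ ?_
    · intro k t ht
      rw [AdExt.eq_inl_add_ad x, add_lie]
      exact add_mem (Submodule.mem_iSup_of_mem k (inl_lie_mem V r _ k t ht))
        (Submodule.mem_iSup_of_mem (k + 1) (ad_lie_mem V r _ k t ht))
    · simp
    · intro s t hs ht
      rw [lie_add]
      exact add_mem hs ht
  have key : ∀ (u : UEnv (AdExt 𝔤)) (v : V), tmul u v ∈ N := by
    intro u v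
    let f : UEnv (AdExt 𝔤) →ₗ[ℂ] Induced (𝔤 := 𝔤) V :=
      (tmulₗ V).comp ((TensorProduct.mk ℂ (UEnv (AdExt 𝔤)) V).flip v)
    have hf : N.comap f = ⊤ := by
      apply UEnv.eq_top_of_one_mem
      · exact Submodule.mem_iSup_of_mem r
          (Submodule.subset_span ⟨0, 1, v, by omega, IsMonomial.one, rfl⟩)
      · intro x u hu
        exact hlie x _ hu
    have : u ∈ N.comap f := by rw [hf]; trivial
    exact this
  rw [eq_top_iff]
  intro t _
  obtain ⟨t, rfl⟩ := tmulₗ_surjective V t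
  induction t with
  | zero => simp
  | tmul u v => exact key u v
  | add s t hs ht => rw [map_add]; exact add_mem (hs trivial) (ht trivial)

/-- The linear endomorphism of the induced module that is induced by `AdExt.dilate`. -/
theorem exists_dilate : ∃ S : Module.End ℂ (Induced (𝔤 := 𝔤) V),
    ∀ (u : UEnv (AdExt 𝔤)) (v : V), S (tmul u v) = tmul (UEnv.map AdExt.dilate u) v := by
  let F : UEnv (AdExt 𝔤) ⊗[ℂ] V →ₗ[ℂ] UEnv (AdExt 𝔤) ⊗[ℂ] V :=
    TensorProduct.map (UEnv.map (AdExt.dilate (𝔤 := 𝔤))).toLinearMap LinearMap.id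
  have hF : ∀ (w : UEnv (AdExt 𝔤)) (t : UEnv (AdExt 𝔤) ⊗[ℂ] V),
      F (w • t) = UEnv.map AdExt.dilate w • F t := by
    intro w t
    induction t with
    | zero => simp
    | tmul u v =>
      change F ((w * u) ⊗ₜ v) = (UEnv.map AdExt.dilate w * UEnv.map AdExt.dilate u) ⊗ₜ v
      rw [← map_mul]
      rfl
    | add s t hs ht => rw [smul_add, map_add, hs, ht, map_add, smul_add]
  have hinl : ∀ a : UEnv 𝔤,
      UEnv.map AdExt.dilate (UEnv.map AdExt.inl a) = UEnv.map AdExt.inl a := by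
    intro a
    let T : Submodule ℂ (UEnv 𝔤) := LinearMap.eqLocus
      ((UEnv.map (AdExt.dilate (𝔤 := 𝔤))).toLinearMap.comp
        (UEnv.map (AdExt.inl (𝔤 := 𝔤))).toLinearMap) (UEnv.map (AdExt.inl (𝔤 := 𝔤))).toLinearMap
    have hT : T = ⊤ := by
      apply UEnv.eq_top_of_one_mem
      · change UEnv.map AdExt.dilate (UEnv.map AdExt.inl 1) = UEnv.map AdExt.inl 1
        simp
      · intro x u hu
        change UEnv.map AdExt.dilate (UEnv.map AdExt.inl (UEnv.ι x * u)) =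
          UEnv.map AdExt.inl (UEnv.ι x * u)
        have hu' : UEnv.map AdExt.dilate (UEnv.map AdExt.inl u) = UEnv.map AdExt.inl u := hu
        rw [map_mul, map_mul, hu', UEnv.map_ι, UEnv.map_ι, AdExt.dilate_inl]
    have : a ∈ T := by rw [hT]; trivial
    exact this
  let J := (balancedRel (𝔤 := 𝔤) V).restrictScalars ℂ
  have hJ : ∀ t ∈ balancedRel (𝔤 := 𝔤) V, F t ∈ balancedRel (𝔤 := 𝔤) V := by
    intro t ht
    induction ht using Submodule.span_induction with
    | mem t ht =>
      obtain ⟨u, a, v, rfl⟩ := ht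
      refine Submodule.subset_span ⟨UEnv.map AdExt.dilate u, a, v, ?_⟩
      rw [map_sub]
      change (UEnv.map AdExt.dilate (u * UEnv.map AdExt.inl a)) ⊗ₜ[ℂ] v - _ = _
      rw [map_mul, hinl]
      rfl
    | zero => simp
    | add s t _ _ hs ht => rw [map_add]; exact add_mem hs ht
    | smul w t _ ht => rw [hF]; exact Submodule.smul_mem _ _ ht
  exact ⟨J.mapQ J F hJ, fun u v ↦ rfl⟩

theorem map_dilate_of_isMonomial {k : ℕ} {u : UEnv (AdExt 𝔤)} (hu : IsMonomial k u) :
    UEnv.map AdExt.dilate u = (2 : ℂ) ^ k • u := by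
  induction hu with
  | one => simp
  | inl_mul x _ ih => rw [map_mul, ih, UEnv.map_ι, AdExt.dilate_inl, mul_smul_comm]
  | ad_mul x _ ih =>
    rw [map_mul, ih, UEnv.map_ι, AdExt.dilate_ad, mul_smul_comm, map_smul, smul_mul_assoc,
      smul_smul, pow_succ]

theorem isInternal_piece (r : ℕ) : DirectSum.IsInternal (piece (𝔤 := 𝔤) V r) := by
  refine DirectSum.isInternal_submodule_of_iSupIndep_of_iSup_eq_top ?_ (iSup_piece V r)
  obtain ⟨S, hS⟩ := exists_dilate (𝔤 := 𝔤) V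
  have hinj : Function.Injective (fun k : ℕ ↦ (2 : ℂ) ^ k) := by
    intro a b hab
    have h : ((2 ^ a : ℕ) : ℂ) = ((2 ^ b : ℕ) : ℂ) := by push_cast; exact hab
    exact Nat.pow_right_injective le_rfl (Nat.cast_injective h)
  have hmap : ∀ (k : ℕ), piece (𝔤 := 𝔤) V r k ≤
      (S.eigenspace ((2 : ℂ) ^ (k - r)) : Submodule ℂ (Induced (𝔤 := 𝔤) V)) := by
    intro k
    refine Submodule.span_le.mpr ?_
    rintro _ ⟨a, u, v, rfl, hu, rfl⟩
    rw [SetLike.mem_coe, Module.End.mem_eigenspace_iff, hS, map_dilate_of_isMonomial hu,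
      Nat.add_sub_cancel_left]
    rfl
  have hbot : ∀ k, k < r → piece (𝔤 := 𝔤) V r k = ⊥ := by
    intro k hk
    rw [piece, Submodule.span_eq_bot]
    rintro _ ⟨a, u, v, h, _⟩
    omega
  have h0 : iSupIndep fun k : ℕ ↦
      (S.eigenspace ((2 : ℂ) ^ k) : Submodule ℂ (Induced (𝔤 := 𝔤) V)) :=
    S.eigenspaces_iSupIndep.comp hinj
  rw [iSupIndep_def] at h0 ⊢
  intro i
  by_cases hi : i < r
  · rw [hbot i hi]; exact disjoint_bot_left
  · refine (h0 (i - r)).mono (hmap i) (iSup₂_le fun j hj ↦ ?_)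
    by_cases hj' : j < r
    · rw [hbot j hj']; exact bot_le
    · exact le_iSup₂_of_le (j - r) (by omega) (hmap j)

/-- The induced module `U(𝔤 ⋉ 𝔤_ad) ⊗_{U(𝔤)} ev_r V`, as a graded module: `V` is placed in
degree `r`, and elements of `𝔤_ad` have degree one. -/
def graded (r : ℕ) : GradedLieMod 𝔤 where
  carrier := Induced (𝔤 := 𝔤) V
  gr := piece V r
  isInternal := isInternal_piece V r
  inl_lie_mem := inl_lie_mem V r
  ad_lie_mem := ad_lie_mem V r

end Induced

end Induced

/-! ### Weights and simple modules -/

section Weights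

open LieAlgebra LieAlgebra.IsKilling

variable {𝔤 : Type u} [LieRing 𝔤] [LieAlgebra ℂ 𝔤] [FiniteDimensional ℂ 𝔤]
  [LieAlgebra.IsSimple ℂ 𝔤] {𝔥 : LieSubalgebra ℂ 𝔤} [𝔥.IsCartanSubalgebra]

/-- The bilinear form on `𝔥^*` that corresponds to the restriction of the Killing form to `𝔥`. -/
def dualForm (α β : Module.Dual ℂ 𝔥) : ℂ :=
  killingForm ℂ 𝔤 ((cartanEquivDual 𝔥).symm α : 𝔥) ((cartanEquivDual 𝔥).symm β : 𝔥)

/-- Dominant integral weights: `P⁺ = {lam ∈ 𝔥^* : lam (h_i) ∈ ℤ_{≥ 0} for all i}`, where the `h_i`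
are the simple coroots. -/
def DominantWeight (b : (rootSystem 𝔥).Base) : Type u :=
  {lam : Module.Dual ℂ 𝔥 // ∀ i ∈ b.support, ∃ n : ℕ, lam ((rootSystem 𝔥).coroot i) = n}

variable {b : (rootSystem 𝔥).Base}

/-- The set `R⁺ = R ∩ Q⁺` of positive roots. -/
def positiveRoots (b : (rootSystem 𝔥).Base) : Set 𝔥.root :=
  {α | (rootSystem 𝔥).root α ∈ AddSubmonoid.closure ((rootSystem 𝔥).root '' b.support)}

/-- The set `{α ∈ R : (α, ξ) = max_{β ∈ R} (β, ξ)}`; the numbers `(β, ξ)` are real. -/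
def maximalRoots (ξ : DominantWeight b) : Set 𝔥.root :=
  {α | ∀ β : 𝔥.root, (dualForm ((rootSystem 𝔥).root β) ξ.1).re ≤
    (dualForm ((rootSystem 𝔥).root α) ξ.1).re}

/-- The set `Γ(lam, S)` of the pairs `(μ, r)` with `μ = lam - ∑_{β ∈ S} n_β β` and
`∑_{β ∈ S} n_β = r` for some `n_β ∈ ℤ_{≥ 0}`. -/
def GammaSet (lam : DominantWeight b) (S : Set 𝔥.root) : Set (DominantWeight b × ℕ) :=
  {p | ∃ n : 𝔥.root → ℕ, (∀ β ∉ S, n β = 0) ∧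
    p.1.1 = lam.1 - ∑ β, n β • (rootSystem 𝔥).root β ∧ ∑ β, n β = p.2}

/-- The left ideal of `U(𝔤)` generated by the defining relations of `V(lam)`: `h - lam(h)` for
`h ∈ 𝔥`, the root vectors of the simple roots `α_i`, and `y ^ (lam(h_i) + 1)` for the root
vectors `y` of the roots `-α_i`. -/
def simpleModuleRel (lam : DominantWeight b) : Submodule (UEnv 𝔤) (UEnv 𝔤) :=
  Submodule.span (UEnv 𝔤)
    ({a | ∃ h : 𝔥, a = UEnv.ι (h : 𝔤) - algebraMap ℂ (UEnv 𝔤) (lam.1 h)} ∪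
     {a | ∃ i ∈ b.support, ∃ x ∈ rootSpace 𝔥 (i.1 : 𝔥 → ℂ), a = UEnv.ι x} ∪
     {a | ∃ i ∈ b.support, ∃ y ∈ rootSpace 𝔥 (-(i.1 : 𝔥 → ℂ)), ∃ n : ℕ,
       lam.1 ((rootSystem 𝔥).coroot i) = n ∧ a = UEnv.ι y ^ (n + 1)})

/-- The simple `𝔤`-module `V(lam)`, as the `U(𝔤)`-module generated by one element subject to the
defining relations. -/
def SimpleModule (lam : DominantWeight b) : Type u := UEnv 𝔤 ⧸ simpleModuleRel lam

namespace SimpleModule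

variable (lam : DominantWeight b)

instance : AddCommGroup (SimpleModule lam) :=
  inferInstanceAs (AddCommGroup (UEnv 𝔤 ⧸ simpleModuleRel lam))

instance : Module (UEnv 𝔤) (SimpleModule lam) :=
  inferInstanceAs (Module (UEnv 𝔤) (UEnv 𝔤 ⧸ simpleModuleRel lam))

instance : Module ℂ (SimpleModule lam) :=
  inferInstanceAs (Module ℂ (UEnv 𝔤 ⧸ simpleModuleRel lam))

instance : IsScalarTower ℂ (UEnv 𝔤) (SimpleModule lam) :=
  inferInstanceAs (IsScalarTower ℂ (UEnv 𝔤) (UEnv 𝔤 ⧸ simpleModuleRel lam))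

instance : LieRingModule 𝔤 (SimpleModule lam) := UEnv.lieRingModule _

instance : LieModule ℂ 𝔤 (SimpleModule lam) := UEnv.lieModule _

end SimpleModule

/-- The multiplicity `[V : ev_r V(lam)] = dim Hom_𝔤(V(lam), V[r])`. -/
def simpleMultiplicity (V : GradedLieMod 𝔤) (p : DominantWeight b × ℕ) : Cardinal.{u} :=
  Module.rank ℂ (SimpleModule p.1 →ₗ⁅ℂ, 𝔤⁆ V.gr p.2)

/-- The objects of the full subcategory `𝒢₂[Γ]`: those objects `V` of `𝒢₂` for which
`[V : ev_r V(lam)] ≠ 0` implies `(lam, r) ∈ Γ`. -/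
def G2Gamma (Γ : Set (DominantWeight b × ℕ)) : ObjectProperty (GradedLieMod 𝔤) :=
  fun V ↦ GradedLieMod.G2 V ∧ ∀ p : DominantWeight b × ℕ, simpleMultiplicity V p ≠ 0 → p ∈ Γ

/-- The graded submodules `K` of `V` such that `V / K` lies in `𝒢₂[Γ]`. -/
def truncationKernels (Γ : Set (DominantWeight b × ℕ)) (V : GradedLieMod 𝔤) :
    Set (LieSubmodule ℂ (AdExt 𝔤) V.carrier) :=
  {K | ∃ hK : V.IsGraded K, G2Gamma Γ (V.quotient K hK)}

/-- The maximal quotient `V^Γ` of `V` that lies in `𝒢₂[Γ]`: the quotient by the intersection of all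
graded submodules `K` such that `V / K` lies in `𝒢₂[Γ]`. -/
def truncation (Γ : Set (DominantWeight b × ℕ)) (V : GradedLieMod 𝔤) : GradedLieMod 𝔤 :=
  V.quotient (sInf (truncationKernels Γ V)) (V.isGraded_sInf _ fun _ hK ↦ hK.1)

/-- `P(lam, r) = U(𝔤 ⋉ 𝔤_ad) ⊗_{U(𝔤)} ev_r V(lam)`. -/
def projectiveModule (lam : DominantWeight b) (r : ℕ) : GradedLieMod 𝔤 :=
  Induced.graded (SimpleModule lam) r

end Weights

end

noncomputable section

/-! ### Generation of `𝔤` by simple root vectors -/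

section Generation

open LieAlgebra LieAlgebra.IsKilling LieModule

variable {𝔤 : Type u} [LieRing 𝔤] [LieAlgebra ℂ 𝔤] [FiniteDimensional ℂ 𝔤]
  [LieAlgebra.IsSimple ℂ 𝔤] {𝔥 : LieSubalgebra ℂ 𝔤} [𝔥.IsCartanSubalgebra]

/-! Since P(μ, r) = τ_r P(μ, 0) and truncation commutes with τ_r, the claim is about P(μ, 0) alone:
truncating at Γ(λ, Ψ), lowered by r in degree, gives the same as truncating at Γ(μ, Ψ). The lowered
set contains Γ(μ, Ψ) because multiplicities add. What remains is that a graded quotient Q of P(μ, 0)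
lying in the category of the larger set already lies in that of the smaller one
(`IsGradedGenerator.g2Gamma_gammaSet`).

Let M be the maximum of (β, ξ) over R; it is positive because Ψ consists of positive roots. By
hypothesis the weight of a singular vector in Q[s] pairs with ξ to exactly (λ, ξ) - (s + r)M. A word
of s root vectors of 𝔤_ad for roots in -Ψ, applied to the generator v, has a weight with this same
pairing. Applying to it an element of 𝔤_ad from 𝔥 or from a root outside -Ψ gives a weight vector of
Q[s + 1] whose pairing is too large. Any singular vector above it has at least as large a pairing, ξ
being dominant, so the result is zero (`ad_lie_eq_zero`). Hence Q[s] is generated under lowering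
operators by the words of length s in -Ψ (`IsGradedGenerator.gr_le_of_adGenerators_subset`), whose
weights lie in Γ(μ, Ψ) in degree s. A singular vector of a finite-dimensional module shares its
weight with a member of any such generating set (`NegGenerates.exists_weight_eq`); the Casimir
operator does here the work of complete reducibility.

For the truncations to lie in their categories, the weight condition is inherited from the quotients
defining them (`g2Gamma_truncation`). Finite dimension is controlled by degree zero, a quotient of
V(μ), and V(μ) has at most one proper submodule of finite codimension
(`SimpleModule.le_of_finiteDimensional_quotient`). -/

theorem exists_lie_eq_of_mem_rootSpace_add {α β γ : Weight ℂ 𝔥 𝔤} (hα : α.IsNonZero)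
    (hγ : γ.IsNonZero) (h : (γ : 𝔥 → ℂ) = α + β) {y : 𝔤} (hy : y ∈ rootSpace 𝔥 γ) :
    ∃ e ∈ rootSpace 𝔥 α, ∃ x ∈ rootSpace 𝔥 β, ⁅e, x⁆ = y := by
  have hk1 : 1 ≤ chainTopCoeff α β := by
    have := ((rootSpace_zsmul_add_ne_bot_iff α β hα 1).mp
      (by rw [one_smul, ← h]; exact γ.genWeightSpace_ne_bot)).1
    exact_mod_cast this
  obtain ⟨x, hx, hx0⟩ := (chainTop α β).exists_ne_zero
  obtain ⟨h', e, f, isSl2, he, hf⟩ := exists_isSl2Triple_of_weight_isNonZero hα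
  obtain rfl := isSl2.h_eq_coroot hα he hf
  have prim : isSl2.HasPrimitiveVectorWith x (chainLength α β : ℂ) :=
    have := lie_mem_genWeightSpace_of_mem_genWeightSpace he hx
    ⟨hx0, (chainLength_smul _ _ hx).symm, by rwa [genWeightSpace_add_chainTop _ _ hα] at this⟩
  -- From the top `x` of the `α`-string through `β`, `f ^ k` reaches `γ` and `f ^ (k + 1)` reaches
  -- `β`. Applying `e` undoes the last step up to the factor `(k + 1) * (length - k)`, nonzero since
  -- `k < length`, and the root space of `γ` is a line.
  obtain ⟨k, hk⟩ : ∃ k, chainTopCoeff α β = k + 1 := ⟨_, (Nat.sub_add_cancel hk1).symm⟩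
  have hle : k + 1 ≤ chainLength α β := hk ▸ chainTopCoeff_le_chainLength α β
  have hz : ((toEnd ℂ 𝔤 𝔤 f) ^ (k + 1)) x ∈ rootSpace 𝔥 β := by
    have := toEnd_pow_apply_mem hf hx (k + 1)
    rwa [coe_chainTop, hk, show (k + 1) • (-(α : 𝔥 → ℂ)) + (((k + 1 : ℕ) : ℤ) • (α : 𝔥 → ℂ) + β)
      = β by module] at this
  have hw : ((toEnd ℂ 𝔤 𝔤 f) ^ k) x ∈ rootSpace 𝔥 γ := by
    have := toEnd_pow_apply_mem hf hx k
    rwa [coe_chainTop, hk, show k • (-(α : 𝔥 → ℂ)) + (((k + 1 : ℕ) : ℤ) • (α : 𝔥 → ℂ) + β)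
      = γ by rw [h]; push_cast; module] at this
  have hw0 := prim.pow_toEnd_f_ne_zero_of_eq_nat rfl (Nat.le_of_succ_le hle)
  have hew := prim.lie_e_pow_succ_toEnd_f k
  obtain ⟨c, hc⟩ : ∃ c : ℂ, c • ((toEnd ℂ 𝔤 𝔤 f) ^ k) x = y := by
    simpa using (finrank_eq_one_iff_of_nonzero' (⟨_, hw⟩ : rootSpace 𝔥 γ) (by simpa using hw0)).mp
      (finrank_rootSpace_eq_one _ hγ) ⟨_, hy⟩
  have hd : (((k : ℂ) + 1) * ((chainLength α β : ℂ) - k)) ≠ 0 := by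
    refine mul_ne_zero (by exact_mod_cast k.succ_ne_zero) (sub_ne_zero.mpr ?_)
    exact_mod_cast (by omega : chainLength α β ≠ k)
  refine ⟨e, he, (c * (((k : ℂ) + 1) * ((chainLength α β : ℂ) - k))⁻¹) •
    ((toEnd ℂ 𝔤 𝔤 f) ^ (k + 1)) x, Submodule.smul_mem _ _ hz, ?_⟩
  rw [lie_smul, hew, smul_smul, mul_assoc, inv_mul_cancel₀ hd, mul_one, hc]

variable (b : (rootSystem 𝔥).Base)

/-- Every positive root is built from a simple one by adding simple roots one at a time, and each
addition is realised by a bracket that fills the new root space. -/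
theorem rootSpace_le_of_isPos (S : LieSubalgebra ℂ 𝔤)
    (hS : ∀ i ∈ b.support, ∀ x ∈ rootSpace 𝔥 (i.1 : 𝔥 → ℂ), x ∈ S) {α : 𝔥.root}
    (hα : b.IsPos α) : ∀ x ∈ rootSpace 𝔥 (α.1 : 𝔥 → ℂ), x ∈ S := by
  refine hα.induction_on_add (p := fun α ↦ ∀ x ∈ rootSpace 𝔥 (α.1 : 𝔥 → ℂ), x ∈ S) hS ?_
  intro i j k hk hi hj x hx
  have hk' : (k.1 : 𝔥 → ℂ) = j.1 + i.1 := by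
    funext h
    have := DFunLike.congr_fun hk h
    simpa [add_comm] using this
  obtain ⟨e, he, y, hy, rfl⟩ := exists_lie_eq_of_mem_rootSpace_add
    (LieSubalgebra.isNonZero_coe_root j) (LieSubalgebra.isNonZero_coe_root k) hk' hx
  exact S.lie_mem (hS j hj e he) (hi y hy)

theorem rootSpace_neg_le_of_isPos (S : LieSubalgebra ℂ 𝔤)
    (hS : ∀ i ∈ b.support, ∀ x ∈ rootSpace 𝔥 (-(i.1 : 𝔥 → ℂ)), x ∈ S) {α : 𝔥.root}
    (hα : b.IsPos α) : ∀ x ∈ rootSpace 𝔥 (-(α.1 : 𝔥 → ℂ)), x ∈ S := by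
  refine hα.induction_on_add (p := fun α ↦ ∀ x ∈ rootSpace 𝔥 (-(α.1 : 𝔥 → ℂ)), x ∈ S) hS ?_
  intro i j k hk hi hj x hx
  have hk' : ((-k.1 : Weight ℂ 𝔥 𝔤) : 𝔥 → ℂ) = (-j.1 : Weight ℂ 𝔥 𝔤) + (-i.1 : Weight ℂ 𝔥 𝔤) := by
    funext h
    have := DFunLike.congr_fun hk h
    simp only [rootSystem_root_apply, LinearMap.add_apply, Weight.toLinear_apply] at this
    simp only [Weight.coe_neg, Pi.neg_apply, Pi.add_apply, this]
    ring
  rw [← Weight.coe_neg] at hx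
  obtain ⟨e, he, y, hy, rfl⟩ := exists_lie_eq_of_mem_rootSpace_add
    (LieSubalgebra.isNonZero_coe_root j).neg (LieSubalgebra.isNonZero_coe_root k).neg hk' hx
  rw [Weight.coe_neg] at he hy
  exact S.lie_mem (hS j hj e he) (hi y hy)

/-- A subspace of `𝔤` containing the Cartan subalgebra and all root spaces is everything. -/
theorem mem_of_cartan_of_rootSpace (S : Submodule ℂ 𝔤) (h0 : ∀ h : 𝔥, (h : 𝔤) ∈ S)
    (hS : ∀ α : 𝔥.root, ∀ x ∈ rootSpace 𝔥 (α.1 : 𝔥 → ℂ), x ∈ S) (x : 𝔤) : x ∈ S := by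
  have htop := congrArg LieSubmodule.toSubmodule (iSup_genWeightSpace_eq_top' ℂ 𝔥 𝔤)
  rw [LieSubmodule.iSup_toSubmodule, LieSubmodule.top_toSubmodule] at htop
  have : (⊤ : Submodule ℂ 𝔤) ≤ S := by
    rw [← htop]
    refine iSup_le fun χ ↦ ?_
    by_cases hχ : χ.IsZero
    · intro y hy
      rw [hχ.eq] at hy
      have : y ∈ (rootSpace 𝔥 (0 : 𝔥 → ℂ)) := hy
      rw [← LieSubmodule.mem_toSubmodule] at this
      rw [rootSpace_zero_eq] at this
      exact h0 ⟨y, this⟩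
    · intro y hy
      exact hS ⟨χ, by simpa using hχ⟩ y hy
  exact this trivial

theorem isPos_or_exists_neg (α : 𝔥.root) :
    b.IsPos α ∨ ∃ β : 𝔥.root, b.IsPos β ∧ (α.1 : 𝔥 → ℂ) = -β.1 := by
  let := (rootSystem 𝔥).indexNeg
  refine (RootPairing.Base.IsPos.or_neg b α).imp_right fun hα ↦ ⟨-α, hα, ?_⟩
  funext h
  have := DFunLike.congr_fun ((rootSystem 𝔥).root_reflectionPerm α α) h
  have h2 : ((-α : 𝔥.root).1 : 𝔥 → ℂ) h = - α.1 h := by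
    rw [RootPairing.reflection_apply_self] at this
    exact this
  rw [Pi.neg_apply, h2, neg_neg]

theorem lieSubalgebra_eq_top (S : LieSubalgebra ℂ 𝔤) (h0 : ∀ h : 𝔥, (h : 𝔤) ∈ S)
    (hS : ∀ i ∈ b.support, ∀ x ∈ rootSpace 𝔥 (i.1 : 𝔥 → ℂ), x ∈ S)
    (hS' : ∀ i ∈ b.support, ∀ x ∈ rootSpace 𝔥 (-(i.1 : 𝔥 → ℂ)), x ∈ S) (x : 𝔤) : x ∈ S := by
  refine mem_of_cartan_of_rootSpace S.toSubmodule h0 (fun α y hy ↦ ?_) x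
  rcases isPos_or_exists_neg b α with hα | ⟨β, hβ, h⟩
  · exact rootSpace_le_of_isPos b S hS hα y hy
  · exact rootSpace_neg_le_of_isPos b S hS' hβ y (h ▸ hy)

end Generation

/-! ### The cone of positive roots and the Casimir eigenvalue -/

section Cone

open LieAlgebra LieAlgebra.IsKilling LieModule

variable {𝔤 : Type u} [LieRing 𝔤] [LieAlgebra ℂ 𝔤] [FiniteDimensional ℂ 𝔤]
  [LieAlgebra.IsSimple ℂ 𝔤] {𝔥 : LieSubalgebra ℂ 𝔤} [𝔥.IsCartanSubalgebra]

/-- The element of `𝔥` that corresponds to a linear form under the Killing form. -/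
abbrev killingDual (σ : Module.Dual ℂ 𝔥) : 𝔥 := (cartanEquivDual 𝔥).symm σ

/-- A root as a linear form on `𝔥`. -/
abbrev rootDual (α : 𝔥.root) : Module.Dual ℂ 𝔥 := (rootSystem 𝔥).root α

theorem killingForm_killingDual (σ : Module.Dual ℂ 𝔥) (h : 𝔥) :
    killingForm ℂ 𝔤 (killingDual σ : 𝔤) (h : 𝔤) = σ h := by
  have := cartanEquivDual_apply_apply (K := ℂ) (L := 𝔤) (H := 𝔥) (killingDual σ) h
  rw [LinearEquiv.apply_symm_apply] at this
  exact this.symm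

theorem apply_killingDual_comm (σ τ : Module.Dual ℂ 𝔥) :
    σ (killingDual τ) = τ (killingDual σ) := by
  rw [← killingForm_killingDual, ← killingForm_killingDual]
  exact traceForm_comm ℂ 𝔤 𝔤 _ _

theorem dualForm_eq (σ τ : Module.Dual ℂ 𝔥) : dualForm σ τ = τ (killingDual σ) := by
  rw [← apply_killingDual_comm]
  exact killingForm_killingDual _ _

/-- The Killing norm of the coroot of α is 4 / (α, α). As a trace it is also the sum of the squares
of the integers β(h_α), in which β = α contributes 4. -/
theorem exists_root_killingDual_pos (α : 𝔥.root) :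
    ∃ r : ℝ, 0 < r ∧ rootDual α (killingDual (rootDual α)) = r := by
  have hα : α.1.IsNonZero := LieSubalgebra.isNonZero_coe_root α
  set c : ℂ := rootDual α (killingDual (rootDual α)) with hc
  have hc0 : c ≠ 0 := root_apply_cartanEquivDual_symm_ne_zero hα
  have h1 : traceForm ℂ 𝔥 𝔤 (coroot α.1) (coroot α.1) = 4 * c⁻¹ := by
    rw [traceForm_coroot, root_apply_coroot hα]
    change (2 : ℕ) • (c⁻¹ • (2 : ℂ)) = _
    rw [nsmul_eq_mul, smul_eq_mul]
    push_cast; ring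
  have h2 : traceForm ℂ 𝔥 𝔤 (coroot α.1) (coroot α.1) =
      ∑ β ∈ 𝔥.root, (β (coroot α.1)) ^ 2 := by
    rw [← restrict_killingForm ℂ 𝔤 𝔥, restrict_killingForm_eq_sum]
    simp [LinearMap.sum_apply, sq]
  obtain ⟨s, hs⟩ : ∃ s : ℤ, 0 < s ∧ ∑ β ∈ 𝔥.root, (β (coroot α.1)) ^ 2 = (s : ℂ) := by
    refine ⟨∑ β ∈ 𝔥.root, (chainBotCoeff α.1 β - chainTopCoeff α.1 β : ℤ) ^ 2, ?_, ?_⟩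
    · refine Finset.sum_pos' (fun _ _ ↦ sq_nonneg _) ⟨α.1, α.2, ?_⟩
      have := apply_coroot_eq_cast α.1 α.1
      rw [root_apply_coroot hα] at this
      have h : (chainBotCoeff α.1 α.1 - chainTopCoeff α.1 α.1 : ℤ) = 2 := by exact_mod_cast this.symm
      rw [h]; norm_num
    · push_cast
      refine Finset.sum_congr rfl fun β _ ↦ ?_
      rw [apply_coroot_eq_cast]; push_cast; rfl
  have hsC : (s : ℂ) ≠ 0 := by exact_mod_cast hs.1.ne'
  refine ⟨4 / s, by have : (0 : ℝ) < s := by exact_mod_cast hs.1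
                    positivity, ?_⟩
  rw [h2, hs.2] at h1
  push_cast
  rw [h1]
  field_simp

variable (b : (rootSystem 𝔥).Base)

/-- The cone `Q⁺`. -/
def posCone : AddSubmonoid (Module.Dual ℂ 𝔥) :=
  AddSubmonoid.closure ((rootSystem 𝔥).root '' b.support)

variable {b}

theorem root_mem_posCone {i : 𝔥.root} (hi : i ∈ b.support) : rootDual i ∈ posCone b :=
  AddSubmonoid.subset_closure ⟨i, hi, rfl⟩

theorem apply_killingDual_root (σ : Module.Dual ℂ 𝔥) (α : 𝔥.root) :
    σ (killingDual (rootDual α)) =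
      σ (coroot α.1) * (rootDual α (killingDual (rootDual α)) / 2) := by
  have hα : α.1.IsNonZero := LieSubalgebra.isNonZero_coe_root α
  have hc0 : rootDual α (killingDual (rootDual α)) ≠ 0 :=
    root_apply_cartanEquivDual_symm_ne_zero hα
  have : σ (coroot α.1) = 2 * ((rootDual α (killingDual (rootDual α)))⁻¹ *
      σ (killingDual (rootDual α))) := by
    change σ (2 • (rootDual α (killingDual (rootDual α)))⁻¹ • killingDual (rootDual α)) = _
    rw [map_nsmul, map_smul, nsmul_eq_mul, smul_eq_mul]
    rfl
  rw [this]; field_simp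

theorem exists_apply_killingDual_nonneg {σ : Module.Dual ℂ 𝔥}
    (hσ : ∀ i ∈ b.support, ∃ n : ℕ, σ (coroot i.1) = n) {p : Module.Dual ℂ 𝔥}
    (hp : p ∈ posCone b) : ∃ r : ℝ, 0 ≤ r ∧ σ (killingDual p) = r := by
  induction hp using AddSubmonoid.closure_induction with
  | mem p hp =>
    obtain ⟨i, hi, rfl⟩ := hp
    obtain ⟨n, hn⟩ := hσ i hi
    obtain ⟨r, hr, hr'⟩ := exists_root_killingDual_pos i
    refine ⟨n * (r / 2), by positivity, ?_⟩
    rw [apply_killingDual_root, hn, hr']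
    push_cast; rfl
  | zero => exact ⟨0, le_rfl, by simp [killingDual]⟩
  | add p q _ _ hp hq =>
    obtain ⟨r, hr, hr'⟩ := hp
    obtain ⟨s, hs, hs'⟩ := hq
    refine ⟨r + s, by positivity, ?_⟩
    rw [killingDual, map_add, map_add, hr', hs']
    push_cast; rfl

theorem eq_zero_of_apply_killingDual_eq_zero {σ : Module.Dual ℂ 𝔥}
    (hσ : ∀ i ∈ b.support, ∃ n : ℕ, 0 < n ∧ σ (coroot i.1) = n) {p : Module.Dual ℂ 𝔥}
    (hp : p ∈ posCone b) (h0 : σ (killingDual p) = 0) : p = 0 := by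
  -- The induction needs nonnegativity together with the vanishing criterion: a sum of two
  -- nonnegative pairings vanishes only if both do.
  suffices ∃ r : ℝ, 0 ≤ r ∧ σ (killingDual p) = r ∧ (r = 0 → p = 0) by
    obtain ⟨r, -, hr, h⟩ := this
    exact h (by rw [h0] at hr; exact_mod_cast hr.symm)
  clear h0
  induction hp using AddSubmonoid.closure_induction with
  | mem p hp =>
    obtain ⟨i, hi, rfl⟩ := hp
    obtain ⟨n, hn0, hn⟩ := hσ i hi
    obtain ⟨r, hr, hr'⟩ := exists_root_killingDual_pos i
    have : 0 < (n : ℝ) * (r / 2) := by positivity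
    refine ⟨n * (r / 2), this.le, ?_, fun h ↦ absurd h this.ne'⟩
    rw [apply_killingDual_root, hn, hr']
    push_cast; rfl
  | zero => exact ⟨0, le_rfl, by simp [killingDual], fun _ ↦ rfl⟩
  | add p q _ _ hp hq =>
    obtain ⟨r, hr, hr', hr0⟩ := hp
    obtain ⟨s, hs, hs', hs0⟩ := hq
    refine ⟨r + s, by positivity, ?_, fun h ↦ ?_⟩
    · rw [killingDual, map_add, map_add, hr', hs']
      push_cast; rfl
    · rw [hr0 (by linarith), hs0 (by linarith), add_zero]

variable (b) in
/-- There is an element of `𝔥` on which all simple roots take the value one. -/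
theorem exists_height : ∃ x : 𝔥, ∀ i ∈ b.support, rootDual i x = 1 := by
  let f : Module.Dual ℂ (Module.Dual ℂ 𝔥) := b.toWeightBasis.constr ℂ fun _ ↦ (1 : ℂ)
  refine ⟨(Module.evalEquiv ℂ 𝔥).symm f, fun i hi ↦ ?_⟩
  rw [Module.apply_evalEquiv_symm_apply]
  have := b.toWeightBasis.constr_basis ℂ (fun _ ↦ (1 : ℂ)) ⟨i, hi⟩
  rwa [RootPairing.Base.toWeightBasis_apply] at this

theorem exists_height_eq {x : 𝔥} (hx : ∀ i ∈ b.support, rootDual i x = 1)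
    {p : Module.Dual ℂ 𝔥} (hp : p ∈ posCone b) : ∃ n : ℕ, p x = n ∧ (n = 0 → p = 0) := by
  induction hp using AddSubmonoid.closure_induction with
  | mem p hp =>
    obtain ⟨i, hi, rfl⟩ := hp
    exact ⟨1, by rw [hx i hi]; simp, fun h ↦ absurd h one_ne_zero⟩
  | zero => exact ⟨0, by simp, fun _ ↦ rfl⟩
  | add p q _ _ hp hq =>
    obtain ⟨r, hr, hr0⟩ := hp
    obtain ⟨s, hs, hs0⟩ := hq
    refine ⟨r + s, by rw [LinearMap.add_apply, hr, hs]; push_cast; rfl, fun h ↦ ?_⟩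
    rw [hr0 (by omega), hs0 (by omega), add_zero]

/-- The two heights are natural numbers with sum zero, and only 0 has height zero in Q⁺. -/
theorem eq_zero_of_add_eq_zero_of_mem_posCone {p q : Module.Dual ℂ 𝔥} (hp : p ∈ posCone b)
    (hq : q ∈ posCone b) (h : p + q = 0) : p = 0 := by
  obtain ⟨x, hx⟩ := exists_height b
  obtain ⟨m, hm, hm0⟩ := exists_height_eq hx hp
  obtain ⟨n, hn, -⟩ := exists_height_eq hx hq
  apply hm0
  have : p x + q x = 0 := by rw [← LinearMap.add_apply, h]; rfl
  rw [hm, hn] at this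
  have : m + n = 0 := by exact_mod_cast this
  omega

variable (b)

open Classical in
/-- The sum of the positive roots. -/
def twoRho : Module.Dual ℂ 𝔥 := ∑ α : 𝔥.root with b.IsPos α, rootDual α

/-- The simple reflection s_i permutes the positive roots other than α_i and changes the sign of
their values on h_i. These values cancel in the sum, leaving α_i(h_i) = 2. -/
theorem twoRho_coroot {i : 𝔥.root} (hi : i ∈ b.support) : twoRho b (coroot i.1) = 2 := by
  classical
  have hi' : i.1.IsNonZero := LieSubalgebra.isNonZero_coe_root i
  have hpi := b.isPos_of_mem_support hi
  rw [twoRho, LinearMap.sum_apply, ← Finset.add_sum_erase _ _ (a := i) (by simpa using hpi),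
    show rootDual i (coroot i.1) = 2 from root_apply_coroot hi']
  suffices h : ∑ α ∈ (Finset.univ.filter fun α : 𝔥.root ↦ b.IsPos α).erase i,
      rootDual α (coroot i.1) = 0 by rw [h, add_zero]
  set S := (Finset.univ.filter fun α : 𝔥.root ↦ b.IsPos α).erase i with hS
  let σ := (rootSystem 𝔥).reflectionPerm i
  have hσσ : ∀ α, σ (σ α) = α := fun α ↦ by simp [σ]
  have hmem : ∀ α ∈ S, σ α ∈ S := by
    intro α hα
    simp only [hS, Finset.mem_erase, Finset.mem_filter, Finset.mem_univ, true_and] at hα ⊢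
    refine ⟨fun h ↦ ?_, hα.2.reflectionPerm hi hα.1⟩
    let := (rootSystem 𝔥).indexNeg
    have h2 : α = -i := by
      rw [← hσσ α, h]
      rfl
    have h3 := (RootPairing.Base.IsPos.neg_iff_not b i).mp (h2 ▸ hα.2)
    exact h3 hpi
  have hsum : ∑ α ∈ S, rootDual α (coroot i.1) = ∑ α ∈ S, rootDual (σ α) (coroot i.1) :=
    Finset.sum_nbij' σ σ hmem hmem (fun α _ ↦ hσσ α) (fun α _ ↦ hσσ α) (fun α _ ↦ by rw [hσσ])
  have hneg : ∀ α, rootDual (σ α) (coroot i.1) = -rootDual α (coroot i.1) := by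
    intro α
    have h := (rootSystem 𝔥).pairing_reflectionPerm i α i
    rw [RootPairing.pairing_reflectionPerm_self_right] at h
    exact h.symm
  simp only [hneg, Finset.sum_neg_distrib] at hsum
  exact self_eq_neg.mp hsum

/-- The eigenvalue of the Casimir operator on a singular vector. -/
def casimirValue (ν : Module.Dual ℂ 𝔥) : ℂ := ν (killingDual ν) + ν (killingDual (twoRho b))

variable {b}

/-- The difference of the two Casimir values is (p, (ν + p) + ν + 2ρ). The second argument is
positive on every simple coroot, because 2ρ contributes 2 and the other terms are dominant. -/
theorem eq_zero_of_casimirValue_add_eq {ν p : Module.Dual ℂ 𝔥} (hp : p ∈ posCone b)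
    (hν : ∀ i ∈ b.support, ∃ n : ℕ, ν (coroot i.1) = n)
    (hνp : ∀ i ∈ b.support, ∃ n : ℕ, (ν + p) (coroot i.1) = n)
    (h : casimirValue b (ν + p) = casimirValue b ν) : p = 0 := by
  refine eq_zero_of_apply_killingDual_eq_zero (σ := (ν + p) + ν + twoRho b) (fun i hi ↦ ?_) hp ?_
  · obtain ⟨m, hm⟩ := hν i hi
    obtain ⟨n, hn⟩ := hνp i hi
    refine ⟨n + m + 2, by omega, ?_⟩
    rw [LinearMap.add_apply, LinearMap.add_apply, hm, hn, twoRho_coroot b hi]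
    push_cast; rfl
  · have h1 := apply_killingDual_comm ν p
    have h2 := apply_killingDual_comm (twoRho b) p
    simp only [casimirValue, killingDual, map_add, LinearMap.add_apply] at h h1 h2 ⊢
    linear_combination h + h1 + h2

end Cone

/-! ### Weight vectors, singular vectors and the Casimir operator -/

section Casimir

open LieAlgebra LieAlgebra.IsKilling LieModule

variable {𝔤 : Type u} [LieRing 𝔤] [LieAlgebra ℂ 𝔤] [FiniteDimensional ℂ 𝔤]
  [LieAlgebra.IsSimple ℂ 𝔤] {𝔥 : LieSubalgebra ℂ 𝔤} [𝔥.IsCartanSubalgebra]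
  {M : Type*} [AddCommGroup M] [Module ℂ M] [LieRingModule 𝔤 M] [LieModule ℂ 𝔤 M]

/-- Weight vectors. -/
def IsWeightVec (k : Module.Dual ℂ 𝔥) (m : M) : Prop := ∀ h : 𝔥, ⁅(h : 𝔤), m⁆ = k h • m

/-- The weight space of weight `k`. -/
def weightSubmodule (M : Type*) [AddCommGroup M] [Module ℂ M] [LieRingModule 𝔤 M]
    [LieModule ℂ 𝔤 M] (k : Module.Dual ℂ 𝔥) : Submodule ℂ M where
  carrier := {m | IsWeightVec k m}
  add_mem' hm hn h := by rw [lie_add, hm h, hn h, smul_add]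
  zero_mem' h := by simp
  smul_mem' c m hm h := by rw [lie_smul, hm h, smul_comm]

theorem iSupIndep_weightSubmodule :
    iSupIndep fun k : Module.Dual ℂ 𝔥 ↦ weightSubmodule (𝔤 := 𝔤) M k := by
  have h := (iSupIndep_genWeightSpace ℂ 𝔥 M).comp
    (f := fun k : Module.Dual ℂ 𝔥 ↦ (k : 𝔥 → ℂ)) DFunLike.coe_injective
  rw [← LieSubmodule.iSupIndep_toSubmodule] at h
  refine h.mono fun k m hm ↦ ?_
  exact weightSpace_le_genWeightSpace M (k : 𝔥 → ℂ) ((mem_weightSpace (k : 𝔥 → ℂ) m).mpr hm)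

/-- A weight vector in a sum of other weight spaces vanishes. -/
theorem IsWeightVec.eq_zero_of_mem_iSup {k : Module.Dual ℂ 𝔥} {m : M} (hm : IsWeightVec k m)
    {T : Set (Module.Dual ℂ 𝔥)} (hT : k ∉ T) (h : m ∈ ⨆ l ∈ T, weightSubmodule (𝔤 := 𝔤) M l) :
    m = 0 := by
  have := (iSupIndep_weightSubmodule (𝔥 := 𝔥) (M := M) k).mono_right
    (show (⨆ l ∈ T, weightSubmodule (𝔤 := 𝔤) M l) ≤ _ from
      iSup₂_le fun l hl ↦ le_iSup₂_of_le l (by rintro rfl; exact hT hl) le_rfl)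
  exact Submodule.disjoint_def.mp this m hm h

theorem IsWeightVec.eq_of_ne_zero {k l : Module.Dual ℂ 𝔥} {m : M} (hk : IsWeightVec k m)
    (hl : IsWeightVec l m) (hm : m ≠ 0) : k = l := by
  ext h
  have := (hk h).symm.trans (hl h)
  exact smul_left_injective ℂ hm this

theorem IsWeightVec.lie {k : Module.Dual ℂ 𝔥} {m : M} (hm : IsWeightVec k m)
    {γ : Module.Dual ℂ 𝔥} {x : 𝔤} (hx : x ∈ rootSpace 𝔥 (γ : 𝔥 → ℂ)) :
    IsWeightVec (k + γ) ⁅x, m⁆ := by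
  intro h
  have : ⁅(h : 𝔤), x⁆ = γ h • x := lie_eq_smul_of_mem_rootSpace hx h
  rw [leibniz_lie, this, hm h, smul_lie, lie_smul, ← add_smul, add_comm]
  rfl

theorem IsWeightVec.map {N : Type*} [AddCommGroup N] [Module ℂ N] [LieRingModule 𝔤 N]
    [LieModule ℂ 𝔤 N] {k : Module.Dual ℂ 𝔥} {m : M} (hm : IsWeightVec k m) (f : M →ₗ⁅ℂ, 𝔤⁆ N) :
    IsWeightVec k (f m) := fun h ↦ by rw [← f.map_lie, hm h, map_smul]

/-- Singular vectors: weight vectors that are killed by the simple root vectors. -/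
structure IsSingular (b : (rootSystem 𝔥).Base) (k : Module.Dual ℂ 𝔥) (m : M) : Prop where
  isWeightVec : IsWeightVec k m
  lie_eq_zero : ∀ i ∈ b.support, ∀ x ∈ rootSpace 𝔥 (i.1 : 𝔥 → ℂ), ⁅x, m⁆ = 0

variable {b : (rootSystem 𝔥).Base}

theorem IsSingular.map {N : Type*} [AddCommGroup N] [Module ℂ N] [LieRingModule 𝔤 N]
    [LieModule ℂ 𝔤 N] {k : Module.Dual ℂ 𝔥} {m : M} (hm : IsSingular b k m)
    (f : M →ₗ⁅ℂ, 𝔤⁆ N) : IsSingular b k (f m) :=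
  ⟨hm.1.map f, fun i hi x hx ↦ by rw [← f.map_lie, hm.2 i hi x hx, map_zero]⟩

/-- The annihilator of a vector is a Lie subalgebra, and the simple root vectors generate all
positive ones. -/
theorem IsSingular.lie_eq_zero_of_isPos {k : Module.Dual ℂ 𝔥} {m : M} (hm : IsSingular b k m)
    {α : 𝔥.root} (hα : b.IsPos α) {x : 𝔤} (hx : x ∈ rootSpace 𝔥 (α.1 : 𝔥 → ℂ)) : ⁅x, m⁆ = 0 := by
  let S : LieSubalgebra ℂ 𝔤 :=
    { carrier := {x | ⁅x, m⁆ = 0}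
      add_mem' := fun {x y} hx hy ↦ by
        change ⁅x + y, m⁆ = 0
        rw [add_lie, show ⁅x, m⁆ = 0 from hx, show ⁅y, m⁆ = 0 from hy, add_zero]
      zero_mem' := zero_lie m
      smul_mem' := fun c x hx ↦ by
        change ⁅c • x, m⁆ = 0
        rw [smul_lie, show ⁅x, m⁆ = 0 from hx, smul_zero]
      lie_mem' := fun {x y} hx hy ↦ by
        change ⁅⁅x, y⁆, m⁆ = 0
        rw [lie_lie, show ⁅x, m⁆ = 0 from hx, show ⁅y, m⁆ = 0 from hy, lie_zero, lie_zero,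
          sub_zero] }
  exact rootSpace_le_of_isPos b S hm.2 hα x hx

/-- Families that are dual under the Killing form define an operator that commutes with `𝔤`. -/
theorem commute_of_dual_families {J : Type*} [Fintype J] (e f : J → 𝔤)
    (h : ∀ z, ∑ j, killingForm ℂ 𝔤 (f j) z • e j = z) (x : 𝔤) (m : M) :
    ⁅x, ∑ j, ⁅e j, ⁅f j, m⁆⁆⁆ = ∑ j, ⁅e j, ⁅f j, ⁅x, m⁆⁆⁆ := by
  -- Duality is symmetric in the two families: by `h`, both sides have the same Killing pairing with
  -- every vector.
  have h' : ∀ z, ∑ j, killingForm ℂ 𝔤 (e j) z • f j = z := by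
    intro z
    rw [← sub_eq_zero, ← Submodule.mem_bot (R := ℂ), ← ker_killingForm_eq_bot ℂ 𝔤]
    rw [LinearMap.mem_ker]
    ext z'
    have := congrArg (fun y ↦ killingForm ℂ 𝔤 y z) (h z')
    simp only [map_sum, map_smul, LinearMap.sum_apply, LinearMap.smul_apply, smul_eq_mul] at this
    simp only [map_sub, map_sum, map_smul, LinearMap.sub_apply, LinearMap.sum_apply,
      LinearMap.smul_apply, smul_eq_mul, LinearMap.zero_apply, sub_eq_zero]
    rw [traceForm_comm ℂ 𝔤 𝔤 z z', ← this]
    exact Finset.sum_congr rfl fun _ _ ↦ mul_comm _ _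
  have h1 : ∀ j, ⁅⁅x, e j⁆, ⁅f j, m⁆⁆ =
      ∑ k, killingForm ℂ 𝔤 (f k) ⁅x, e j⁆ • ⁅e k, ⁅f j, m⁆⁆ := by
    intro j
    conv_lhs => rw [← h ⁅x, e j⁆]
    simp [sum_lie]
  have h2 : ∀ k, ⁅e k, ⁅⁅x, f k⁆, m⁆⁆ =
      ∑ j, killingForm ℂ 𝔤 (e j) ⁅x, f k⁆ • ⁅e k, ⁅f j, m⁆⁆ := by
    intro j
    conv_lhs => rw [← h' ⁅x, f j⁆]
    simp [sum_lie, lie_sum]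
  -- By invariance of the Killing form, the expansions of `⁅x, e j⁆` and `⁅x, f k⁆` have opposite
  -- coefficients, so the two commutator sums cancel.
  have h3 : ∀ j k, killingForm ℂ 𝔤 (e j) ⁅x, f k⁆ = -killingForm ℂ 𝔤 (f k) ⁅x, e j⁆ := by
    intro j k
    have := traceForm_apply_lie_apply ℂ 𝔤 𝔤 (e j) x (f k)
    rw [killingForm, ← this, traceForm_comm, ← lie_skew, map_neg]
  have : ∑ j, ⁅⁅x, e j⁆, ⁅f j, m⁆⁆ + ∑ k, ⁅e k, ⁅⁅x, f k⁆, m⁆⁆ = 0 := by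
    simp only [h1, h2, h3, neg_smul, Finset.sum_neg_distrib]
    rw [Finset.sum_comm, add_neg_cancel]
  rw [lie_sum]
  simp only [leibniz_lie x (e _), leibniz_lie x (f _), lie_add, Finset.sum_add_distrib]
  rw [← add_assoc, this, zero_add]

theorem exists_dual_rootVectors (α : 𝔥.root) : ∃ e ∈ rootSpace 𝔥 (α.1 : 𝔥 → ℂ),
    ∃ f ∈ rootSpace 𝔥 (-(α.1 : 𝔥 → ℂ)), killingForm ℂ 𝔤 e f = 1 := by
  obtain ⟨e, he, he0⟩ := α.1.exists_ne_zero
  obtain ⟨f, hf, hef⟩ : ∃ f ∈ rootSpace 𝔥 (-(α.1 : 𝔥 → ℂ)), killingForm ℂ 𝔤 e f ≠ 0 := by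
    contrapose! he0
    simpa using mem_ker_killingForm_of_mem_rootSpace_of_forall_rootSpace_neg ℂ 𝔤 𝔥 he he0
  refine ⟨e, he, (killingForm ℂ 𝔤 e f)⁻¹ • f, Submodule.smul_mem _ _ hf, ?_⟩
  rw [map_smul, smul_eq_mul, inv_mul_cancel₀ hef]

-- The operator is the sum of products over a basis of 𝔥 with its Killing dual and over root vectors
-- e_α, f_α normalised to pair to 1. On a singular vector the part from 𝔥 gives (ν, ν). A positive
-- root gives [e_α, f_α]w = (ν, α)w, and a negative root gives 0 because f_α is then a raising
-- operator.
variable (M b) in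
theorem exists_casimir : ∃ Ω : Module.End ℂ M, (∀ (x : 𝔤) (m : M), ⁅x, Ω m⁆ = Ω ⁅x, m⁆) ∧
    ∀ (ν : Module.Dual ℂ 𝔥) (w : M), IsSingular b ν w → Ω w = casimirValue b ν • w := by
  classical
  choose e he f hf hef using exists_dual_rootVectors (𝔥 := 𝔥)
  let B := Module.finBasis ℂ 𝔥
  let J := Fin (Module.finrank ℂ 𝔥) ⊕ 𝔥.root
  let E : J → 𝔤 := Sum.elim (fun j ↦ (B j : 𝔤)) e
  let F : J → 𝔤 := Sum.elim (fun j ↦ (killingDual (B.coord j) : 𝔤)) f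
  have h0 : ∀ h : 𝔥, (h : 𝔤) ∈ rootSpace 𝔥 (0 : 𝔥 → ℂ) := by
    intro h
    rw [← LieSubmodule.mem_toSubmodule, rootSpace_zero_eq]
    exact h.2
  have hdual : ∀ z, ∑ j, killingForm ℂ 𝔤 (F j) z • E j = z := by
    intro z
    let S : Submodule ℂ 𝔤 := LinearMap.eqLocus
      (∑ j, (killingForm ℂ 𝔤 (F j)).smulRight (E j)) LinearMap.id
    have hS : ∀ z, z ∈ S ↔ ∑ j, killingForm ℂ 𝔤 (F j) z • E j = z := by
      intro z
      simp [S, LinearMap.mem_eqLocus, LinearMap.sum_apply]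
    rw [← hS]
    refine mem_of_cartan_of_rootSpace (𝔥 := 𝔥) S (fun h ↦ ?_) (fun α x hx ↦ ?_) z
    · rw [hS, Fintype.sum_sum_type]
      have h1 : ∀ α, killingForm ℂ 𝔤 (f α) h = 0 := fun α ↦
        killingForm_apply_eq_zero_of_mem_rootSpace_of_add_ne_zero ℂ 𝔤 𝔥 (hf α) (h0 h)
          (by simp)
      simp only [F, E, Sum.elim_inl, Sum.elim_inr, h1, zero_smul, Finset.sum_const_zero, add_zero,
        killingForm_killingDual]
      have := congrArg 𝔥.toSubmodule.subtype (B.sum_repr h)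
      rwa [map_sum] at this
    · rw [hS, Fintype.sum_sum_type]
      have h1 : ∀ h : 𝔥, killingForm ℂ 𝔤 h x = 0 := fun h ↦
        killingForm_apply_eq_zero_of_mem_rootSpace_of_add_ne_zero ℂ 𝔤 𝔥 (h0 h) hx
          (by simp)
      have h2 : ∀ β, β ≠ α → killingForm ℂ 𝔤 (f β) x = 0 := by
        intro β hβ
        refine killingForm_apply_eq_zero_of_mem_rootSpace_of_add_ne_zero ℂ 𝔤 𝔥 (hf β) hx ?_
        intro h
        rw [neg_add_eq_zero] at h
        exact hβ (Subtype.ext (DFunLike.coe_injective h))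
      simp only [F, E, Sum.elim_inl, Sum.elim_inr, h1, zero_smul, Finset.sum_const_zero, zero_add]
      rw [Finset.sum_eq_single α (fun β _ hβ ↦ by rw [h2 β hβ, zero_smul]) (by simp)]
      have he0 : (⟨e α, he α⟩ : rootSpace 𝔥 (α.1 : 𝔥 → ℂ)) ≠ 0 := by
        intro h
        have h' : e α = 0 := congrArg Subtype.val h
        have := hef α
        rw [h'] at this
        simp at this
      obtain ⟨c, hc⟩ := (finrank_eq_one_iff_of_nonzero' _ he0).mp
        (finrank_rootSpace_eq_one _ (LieSubalgebra.isNonZero_coe_root α)) ⟨x, hx⟩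
      have hc' : c • e α = x := congrArg Subtype.val hc
      have hfe : killingForm ℂ 𝔤 (f α) (e α) = 1 := by
        rw [← hef α]; exact traceForm_comm ℂ 𝔤 𝔤 _ _
      rw [← hc', map_smul, hfe, smul_eq_mul, mul_one]
  refine ⟨∑ j, toEnd ℂ 𝔤 M (E j) ∘ₗ toEnd ℂ 𝔤 M (F j), fun x m ↦ ?_, fun ν w hw ↦ ?_⟩
  · simp only [LinearMap.sum_apply, LinearMap.comp_apply, toEnd_apply_apply]
    exact commute_of_dual_families E F hdual x m
  · simp only [LinearMap.sum_apply, LinearMap.comp_apply, toEnd_apply_apply]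
    rw [Fintype.sum_sum_type, casimirValue, add_smul]
    congr 1
    · simp only [E, F, Sum.elim_inl]
      have : ∀ j, ⁅(B j : 𝔤), ⁅(killingDual (B.coord j) : 𝔤), w⁆⁆ =
          (B.repr (killingDual ν) j * ν (B j)) • w := by
        intro j
        rw [hw.1, lie_smul, hw.1, smul_smul, apply_killingDual_comm]
        rfl
      simp only [this]
      rw [← Finset.sum_smul]
      conv_rhs => rw [← B.sum_repr (killingDual ν)]
      rw [map_sum]
      simp only [map_smul, smul_eq_mul]
    · simp only [E, F, Sum.elim_inr]
      have hp : ∀ α, b.IsPos α → ⁅e α, ⁅f α, w⁆⁆ = ν (killingDual (rootDual α)) • w := by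
        intro α hα
        have h1 := hw.lie_eq_zero_of_isPos hα (he α)
        have h2 := lie_eq_killingForm_smul_of_mem_rootSpace_of_mem_rootSpace_neg (he α) (hf α)
        rw [hef, one_smul] at h2
        rw [leibniz_lie, h1, lie_zero, add_zero, h2]
        exact hw.1 _
      have hn : ∀ α, ¬ b.IsPos α → ⁅e α, ⁅f α, w⁆⁆ = 0 := by
        intro α hα
        obtain ⟨β, hβ, h⟩ := (isPos_or_exists_neg b α).resolve_left hα
        have hfα := hf α
        rw [h, neg_neg] at hfα
        rw [hw.lie_eq_zero_of_isPos hβ hfα, lie_zero]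
      rw [twoRho, killingDual, map_sum, map_sum, Finset.sum_smul, Finset.sum_filter]
      refine Finset.sum_congr rfl fun α _ ↦ ?_
      by_cases hα : b.IsPos α
      · rw [if_pos hα, hp α hα]
      · rw [if_neg hα, hn α hα]

end Casimir

/-! ### Finite-dimensional modules -/

section FiniteDimensionalModules

open LieAlgebra LieAlgebra.IsKilling LieModule

variable {𝔤 : Type u} [LieRing 𝔤] [LieAlgebra ℂ 𝔤] [FiniteDimensional ℂ 𝔤]
  [LieAlgebra.IsSimple ℂ 𝔤] {𝔥 : LieSubalgebra ℂ 𝔤} [𝔥.IsCartanSubalgebra]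
  {M : Type*} [AddCommGroup M] [Module ℂ M] [LieRingModule 𝔤 M] [LieModule ℂ 𝔤 M]
  {b : (rootSystem 𝔥).Base}

theorem IsWeightVec.lie_root {k : Module.Dual ℂ 𝔥} {m : M} (hm : IsWeightVec k m)
    {α : 𝔥.root} {x : 𝔤} (hx : x ∈ rootSpace 𝔥 (α.1 : 𝔥 → ℂ)) :
    IsWeightVec (k + rootDual α) ⁅x, m⁆ := hm.lie hx

theorem IsWeightVec.lie_neg_root {k : Module.Dual ℂ 𝔥} {m : M} (hm : IsWeightVec k m)
    {α : 𝔥.root} {x : 𝔤} (hx : x ∈ rootSpace 𝔥 (-(α.1 : 𝔥 → ℂ))) :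
    IsWeightVec (k - rootDual α) ⁅x, m⁆ := by
  rw [sub_eq_add_neg]
  exact hm.lie hx

/-- Apply simple root vectors for as long as the result is nonzero. Distinct heights give distinct
eigenvalues of the element `x`, so only finitely many heights occur and a vector of maximal height
is singular. -/
theorem IsWeightVec.exists_isSingular [FiniteDimensional ℂ M] {k : Module.Dual ℂ 𝔥} {m : M}
    (hm : IsWeightVec k m) (hm0 : m ≠ 0) (b : (rootSystem 𝔥).Base) :
    ∃ p ∈ posCone b, ∃ w : M, w ≠ 0 ∧ IsSingular b (k + p) w := by
  obtain ⟨x, hx⟩ := exists_height b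
  let S : Set ℕ := {n | ∃ p ∈ posCone b, p x = n ∧ ∃ w : M, w ≠ 0 ∧ IsWeightVec (k + p) w}
  have hfin : S.Finite := by
    have h := Module.End.finite_hasEigenvalue (toEnd ℂ 𝔤 M (x : 𝔤))
    have hinj : Function.Injective fun n : ℕ ↦ k x + (n : ℂ) := by
      intro a c hac
      exact_mod_cast add_left_cancel hac
    refine (h.preimage hinj.injOn).subset ?_
    rintro n ⟨p, -, hpx, w, hw0, hw⟩
    refine Module.End.hasEigenvalue_of_hasEigenvector (x := w) ⟨?_, hw0⟩
    rw [Module.End.mem_eigenspace_iff, toEnd_apply_apply, hw x, LinearMap.add_apply, hpx]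
  have hne : S.Nonempty := ⟨0, 0, zero_mem _, by simp, m, hm0, by rwa [add_zero]⟩
  obtain ⟨n, hn⟩ := hfin.exists_maximal hne
  obtain ⟨⟨p, hp, hpx, w, hw0, hw⟩, hmax⟩ := hn
  refine ⟨p, hp, w, hw0, hw, fun i hi y hy ↦ ?_⟩
  by_contra h0
  have : n + 1 ∈ S := by
    refine ⟨p + rootDual i, add_mem hp (root_mem_posCone hi), ?_, _, h0, ?_⟩
    · rw [LinearMap.add_apply, hpx, hx i hi]; push_cast; rfl
    · rw [← add_assoc]; exact hw.lie_root hy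
  have := hmax this (Nat.le_succ n)
  omega

/-- A singular vector is primitive for the 𝔰𝔩₂ of each simple root, which in finite dimension forces
a natural eigenvalue and the nilpotency relation. Thus the defining relations of V(ν) hold
automatically. -/
theorem IsSingular.exists_apply_coroot_eq [FiniteDimensional ℂ M] {ν : Module.Dual ℂ 𝔥} {w : M}
    (hw : IsSingular b ν w) (hw0 : w ≠ 0) {i : 𝔥.root} (hi : i ∈ b.support) :
    ∃ n : ℕ, ν (coroot i.1) = n ∧ ∀ y ∈ rootSpace 𝔥 (-(i.1 : 𝔥 → ℂ)),
      ((toEnd ℂ 𝔤 M y) ^ (n + 1)) w = 0 := by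
  have hα : i.1.IsNonZero := LieSubalgebra.isNonZero_coe_root i
  obtain ⟨h, e, f, ht, he, hf⟩ := exists_isSl2Triple_of_weight_isNonZero hα
  have hh := ht.h_eq_coroot hα he hf
  have P : ht.HasPrimitiveVectorWith w (ν (coroot i.1)) :=
    ⟨hw0, by rw [hh]; exact hw.1 _, hw.2 i hi e he⟩
  obtain ⟨n, hn⟩ := P.exists_nat
  refine ⟨n, hn, fun y hy ↦ ?_⟩
  have hf0 : (⟨f, hf⟩ : rootSpace 𝔥 (-i.1 : Weight ℂ 𝔥 𝔤)) ≠ 0 := fun h ↦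
    ht.f_ne_zero (congrArg Subtype.val h)
  obtain ⟨c, hc⟩ := (finrank_eq_one_iff_of_nonzero' _ hf0).mp
    (finrank_rootSpace_eq_one _ hα.neg) ⟨y, hy⟩
  have hc' : c • f = y := congrArg Subtype.val hc
  rw [← hc', map_smul, smul_pow, LinearMap.smul_apply, P.pow_toEnd_f_eq_zero_of_eq_nat hn,
    smul_zero]

/-- Every subspace that contains `A` and is stable under the root vectors of the negatives of the
simple roots is everything. -/
def NegGenerates (b : (rootSystem 𝔥).Base) (A : Set M) : Prop :=
  ∀ N : Submodule ℂ M, A ⊆ N →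
    (∀ i ∈ b.support, ∀ y ∈ rootSpace 𝔥 (-(i.1 : 𝔥 → ℂ)), ∀ m ∈ N, ⁅y, m⁆ ∈ N) → N = ⊤

theorem NegGenerates.image {N : Type*} [AddCommGroup N] [Module ℂ N] [LieRingModule 𝔤 N]
    [LieModule ℂ 𝔤 N] {A : Set M} (hA : NegGenerates b A) (f : M →ₗ⁅ℂ, 𝔤⁆ N)
    (hf : Function.Surjective f) : NegGenerates b (f '' A) := by
  intro S hS hy
  have := hA (S.comap (f : M →ₗ[ℂ] N)) (fun a ha ↦ hS ⟨a, ha, rfl⟩)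
    (fun i hi y hyi m hm ↦ by
      change f ⁅y, m⁆ ∈ S
      rw [f.map_lie]
      exact hy i hi y hyi _ hm)
  rw [eq_top_iff]
  rintro n -
  obtain ⟨m, rfl⟩ := hf n
  have : m ∈ S.comap (f : M →ₗ[ℂ] N) := this ▸ trivial
  exact this

/-- The weight spaces for weights below that of some nonzero generator span a subspace stable under
lowering, hence everything. By independence of weight spaces, no other weight can occur. -/
theorem NegGenerates.exists_weight_ge {A : Set M} (hA : NegGenerates b A)
    (hA' : ∀ a ∈ A, ∃ k : Module.Dual ℂ 𝔥, IsWeightVec k a) {ν : Module.Dual ℂ 𝔥} {w : M}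
    (hw : IsWeightVec ν w) (hw0 : w ≠ 0) :
    ∃ a ∈ A, a ≠ 0 ∧ ∃ p ∈ posCone b, IsWeightVec (ν + p) a := by
  let T : Set (Module.Dual ℂ 𝔥) := {l | ∃ a ∈ A, a ≠ 0 ∧ ∃ p ∈ posCone b, IsWeightVec (l + p) a}
  by_contra hν
  have htop := hA (⨆ l ∈ T, weightSubmodule (𝔤 := 𝔤) M l) (fun a ha ↦ ?_) fun i hi y hy m hm ↦ ?_
  · exact hw0 (hw.eq_zero_of_mem_iSup (T := T) hν (htop ▸ trivial))
  · by_cases h0 : a = 0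
    · rw [h0]; exact zero_mem _
    · obtain ⟨k, hk⟩ := hA' a ha
      exact Submodule.mem_iSup_of_mem k (Submodule.mem_iSup_of_mem
        ⟨a, ha, h0, 0, zero_mem _, by rwa [add_zero]⟩ hk)
  · induction hm using Submodule.iSup_induction' with
    | zero => simp
    | add m n _ _ hm hn => rw [lie_add]; exact add_mem hm hn
    | mem l m hm =>
      induction hm using Submodule.iSup_induction' with
      | zero => simp
      | add m n _ _ hm hn => rw [lie_add]; exact add_mem hm hn
      | mem hl m hm =>
        obtain ⟨a, ha, h0, p, hp, hap⟩ := hl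
        refine Submodule.mem_iSup_of_mem (l - rootDual i) (Submodule.mem_iSup_of_mem
          ⟨a, ha, h0, p + rootDual i, add_mem hp (root_mem_posCone hi), ?_⟩ ?_)
        · rwa [show l - rootDual i + (p + rootDual i) = l + p by abel]
        · exact IsWeightVec.lie_neg_root hm hy

/-- The weight of a singular vector of a finite-dimensional module occurs among the weights of any
set of weight vectors that generates the module under the negative root vectors. -/
theorem NegGenerates.exists_weight_eq [FiniteDimensional ℂ M] {A : Set M}
    (hA : NegGenerates b A) (hA' : ∀ a ∈ A, ∃ k : Module.Dual ℂ 𝔥, IsWeightVec k a)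
    {ν : Module.Dual ℂ 𝔥} {w : M} (hw : IsSingular b ν w) (hw0 : w ≠ 0) :
    ∃ a ∈ A, a ≠ 0 ∧ IsWeightVec ν a := by
  -- With `N` maximal among the submodules avoiding `w`, every nonzero submodule of the quotient by
  -- `N` contains the image of `w`.
  obtain ⟨N, hN, hmax⟩ : ∃ N : LieSubmodule ℂ 𝔤 M, w ∉ N ∧
      ∀ N' : LieSubmodule ℂ 𝔤 M, N < N' → w ∈ N' := by
    obtain ⟨N, hN, h⟩ := WellFounded.has_min (wellFounded_gt (α := LieSubmodule ℂ 𝔤 M))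
      {N | w ∉ N} ⟨⊥, by simpa using hw0⟩
    exact ⟨N, hN, fun N' hN' ↦ by_contra fun h' ↦ h N' h' hN'⟩
  let π := LieSubmodule.Quotient.mk' N
  have hπ : Function.Surjective π := LieSubmodule.Quotient.surjective_mk' N
  have hπ0 : ∀ m, π m = 0 ↔ m ∈ N := fun m ↦ LieSubmodule.Quotient.mk_eq_zero'
  have hw1 := hw.map π
  have hw10 : π w ≠ 0 := by rwa [Ne, hπ0]
  have hfd : FiniteDimensional ℂ (M ⧸ N) :=
    Module.Finite.of_surjective (π : M →ₗ[ℂ] M ⧸ N) hπ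
  have hAq : ∀ a ∈ π '' A, ∃ k : Module.Dual ℂ 𝔥, IsWeightVec k a := by
    rintro _ ⟨a, ha, rfl⟩
    obtain ⟨k, hk⟩ := hA' a ha
    exact ⟨k, hk.map π⟩
  obtain ⟨_, ⟨a, ha, rfl⟩, ha0, p, hp, hpa⟩ :=
    (hA.image π hπ).exists_weight_ge hAq hw1.1 hw10
  obtain ⟨q, hq, w', hw'0, hw'⟩ := hpa.exists_isSingular ha0 b
  obtain ⟨Ω, hΩ, hΩs⟩ := exists_casimir (M ⧸ N) b
  -- The preimage of a Casimir eigenspace is a submodule. As it contains a lift of the singular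
  -- vector `w'`, it is strictly larger than `N`, so it contains `w`: the Casimir acts on both
  -- vectors by the same scalar.
  have hcas : casimirValue b ν = casimirValue b (ν + p + q) := by
    let K : LieSubmodule ℂ 𝔤 M :=
      { carrier := {m | Ω (π m) = casimirValue b (ν + p + q) • π m}
        add_mem' := fun {m n} hm hn ↦ by
          change Ω (π (m + n)) = _
          rw [map_add, map_add, show Ω (π m) = _ from hm, show Ω (π n) = _ from hn, smul_add]
        zero_mem' := by
          change Ω (π 0) = _ • π 0
          rw [map_zero, map_zero, smul_zero]
        smul_mem' := fun c m hm ↦ by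
          change Ω (π (c • m)) = _
          rw [map_smul, map_smul, show Ω (π m) = _ from hm, smul_comm]
        lie_mem := fun {x m} hm ↦ by
          change Ω (π ⁅x, m⁆) = _
          rw [π.map_lie, ← hΩ, show Ω (π m) = _ from hm, lie_smul] }
    have hNK : N ≤ K := by
      intro m hm
      change Ω (π m) = _ • π m
      rw [(hπ0 m).mpr hm, map_zero, smul_zero]
    obtain ⟨m', rfl⟩ := hπ w'
    have hlt : N < K := lt_of_le_of_ne hNK fun h ↦ by
      have : m' ∈ K := hΩs _ _ hw'
      rw [← h] at this
      exact hw'0 ((hπ0 m').mpr this)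
    have h1 : Ω (π w) = casimirValue b (ν + p + q) • π w := hmax K hlt
    rw [hΩs _ _ hw1] at h1
    exact smul_left_injective ℂ hw10 h1
  -- Both `ν` and `ν + p + q` are weights of singular vectors in finite dimension, hence dominant,
  -- so equal Casimir values force them to coincide.
  have hpq : p + q = 0 := by
    refine eq_zero_of_casimirValue_add_eq (b := b) (ν := ν) (add_mem hp hq) (fun i hi ↦ ?_)
      (fun i hi ↦ ?_) (by rw [hcas, add_assoc])
    · obtain ⟨n, hn, -⟩ := hw1.exists_apply_coroot_eq hw10 hi
      exact ⟨n, hn⟩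
    · obtain ⟨n, hn, -⟩ := hw'.exists_apply_coroot_eq hw'0 hi
      exact ⟨n, by rw [← add_assoc]; exact hn⟩
  have hp0 : p = 0 := eq_zero_of_add_eq_zero_of_mem_posCone hp hq hpq
  obtain ⟨k, hk⟩ := hA' a ha
  have : k = ν := by
    have := (hk.map π).eq_of_ne_zero hpa ha0
    rwa [hp0, add_zero] at this
  exact ⟨a, ha, fun h ↦ ha0 (by rw [h, map_zero]), this ▸ hk⟩

/-- The difference of two distinct simple roots is neither zero nor a root. -/
theorem lie_eq_zero_of_simple_of_neg_simple {i j : 𝔥.root} (hi : i ∈ b.support)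
    (hj : j ∈ b.support) (hij : i ≠ j) {x y : 𝔤} (hx : x ∈ rootSpace 𝔥 (i.1 : 𝔥 → ℂ))
    (hy : y ∈ rootSpace 𝔥 (-(j.1 : 𝔥 → ℂ))) : ⁅x, y⁆ = 0 := by
  have h := lie_mem_genWeightSpace_of_mem_genWeightSpace hx hy
  by_contra h0
  have hne : rootSpace 𝔥 ((i.1 : 𝔥 → ℂ) + -(j.1 : 𝔥 → ℂ)) ≠ ⊥ := by
    intro hb
    have h' : ⁅x, y⁆ ∈ rootSpace 𝔥 ((i.1 : 𝔥 → ℂ) + -(j.1 : 𝔥 → ℂ)) := h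
    rw [hb] at h'
    exact h0 (by simpa using h')
  let χ : Weight ℂ 𝔥 𝔤 := ⟨_, hne⟩
  have hχ : χ.IsNonZero := by
    intro hz
    have : (i.1 : 𝔥 → ℂ) + -(j.1 : 𝔥 → ℂ) = 0 := hz
    rw [← sub_eq_add_neg, sub_eq_zero] at this
    exact hij (Subtype.ext (DFunLike.coe_injective this))
  refine b.sub_notMem_range_root hi hj ⟨⟨χ, by simpa using hχ⟩, ?_⟩
  ext t
  change (i.1 : 𝔥 → ℂ) t + -(j.1 : 𝔥 → ℂ) t = i.1 t - j.1 t
  ring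

/-- A module generated by a singular vector is generated by it under the negative root vectors. -/
theorem IsSingular.negGenerates {μ : Module.Dual ℂ 𝔥} {v : M} (hv : IsSingular b μ v)
    (hgen : ∀ N : LieSubmodule ℂ 𝔤 M, v ∈ N → N = ⊤) : NegGenerates b {v} := by
  intro N₁ hN₁ hN₁y
  -- `N` is the smallest subspace containing `v` and stable under lowering. To see that other
  -- operators preserve it, consider the part of `N` that they map into `N`: it belongs to `I`
  -- again, so by minimality it is all of `N`. This is done for 𝔥, then for raising operators, whose
  -- brackets with lowering ones fall into 𝔥.
  let I : Set (Submodule ℂ M) := {N | v ∈ N ∧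
    ∀ i ∈ b.support, ∀ y ∈ rootSpace 𝔥 (-(i.1 : 𝔥 → ℂ)), ∀ m ∈ N, ⁅y, m⁆ ∈ N}
  let N := sInf I
  have hvN : v ∈ N := Submodule.mem_sInf.mpr fun S hS ↦ hS.1
  have hyN : ∀ i ∈ b.support, ∀ y ∈ rootSpace 𝔥 (-(i.1 : 𝔥 → ℂ)), ∀ m ∈ N, ⁅y, m⁆ ∈ N :=
    fun i hi y hy m hm ↦ Submodule.mem_sInf.mpr fun S hS ↦
      hS.2 i hi y hy m (Submodule.mem_sInf.mp hm S hS)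
  have hhN : ∀ m ∈ N, ∀ h : 𝔥, ⁅(h : 𝔤), m⁆ ∈ N := by
    let S : Submodule ℂ M :=
      { carrier := {m | m ∈ N ∧ ∀ h : 𝔥, ⁅(h : 𝔤), m⁆ ∈ N}
        add_mem' := fun {m n} hm hn ↦
          ⟨add_mem hm.1 hn.1, fun h ↦ by rw [lie_add]; exact add_mem (hm.2 h) (hn.2 h)⟩
        zero_mem' := ⟨zero_mem _, fun h ↦ by rw [lie_zero]; exact zero_mem _⟩
        smul_mem' := fun c m hm ↦ ⟨N.smul_mem c hm.1, fun h ↦ by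
          rw [lie_smul]; exact N.smul_mem c (hm.2 h)⟩ }
    have hS : S ∈ I := by
      refine ⟨⟨hvN, fun h ↦ by rw [hv.1]; exact N.smul_mem _ hvN⟩, fun i hi y hy m hm ↦
        ⟨hyN i hi y hy m hm.1, fun h ↦ ?_⟩⟩
      have : ⁅(h : 𝔤), y⁆ = (-(i.1 : 𝔥 → ℂ)) h • y := lie_eq_smul_of_mem_rootSpace hy h
      rw [leibniz_lie, this, smul_lie]
      exact add_mem (N.smul_mem _ (hyN i hi y hy m hm.1)) (hyN i hi y hy _ (hm.2 h))
    exact fun m hm ↦ (Submodule.mem_sInf.mp hm S hS).2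
  have heN : ∀ m ∈ N, ∀ i ∈ b.support, ∀ x ∈ rootSpace 𝔥 (i.1 : 𝔥 → ℂ), ⁅x, m⁆ ∈ N := by
    let S : Submodule ℂ M :=
      { carrier := {m | m ∈ N ∧ ∀ i ∈ b.support, ∀ x ∈ rootSpace 𝔥 (i.1 : 𝔥 → ℂ), ⁅x, m⁆ ∈ N}
        add_mem' := fun {m n} hm hn ↦ ⟨add_mem hm.1 hn.1, fun i hi x hx ↦ by
          rw [lie_add]; exact add_mem (hm.2 i hi x hx) (hn.2 i hi x hx)⟩
        zero_mem' := ⟨zero_mem _, fun i hi x hx ↦ by rw [lie_zero]; exact zero_mem _⟩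
        smul_mem' := fun c m hm ↦ ⟨N.smul_mem c hm.1, fun i hi x hx ↦ by
          rw [lie_smul]; exact N.smul_mem c (hm.2 i hi x hx)⟩ }
    have hS : S ∈ I := by
      refine ⟨⟨hvN, fun i hi x hx ↦ by rw [hv.2 i hi x hx]; exact zero_mem _⟩,
        fun j hj y hy m hm ↦ ⟨hyN j hj y hy m hm.1, fun i hi x hx ↦ ?_⟩⟩
      rw [leibniz_lie]
      refine add_mem ?_ (hyN j hj y hy _ (hm.2 i hi x hx))
      by_cases hij : i = j
      · subst hij
        rw [lie_eq_killingForm_smul_of_mem_rootSpace_of_mem_rootSpace_neg hx hy, smul_lie]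
        exact N.smul_mem _ (hhN m hm.1 _)
      · rw [lie_eq_zero_of_simple_of_neg_simple hi hj hij hx hy, zero_lie]
        exact zero_mem _
    exact fun m hm ↦ (Submodule.mem_sInf.mp hm S hS).2
  let L : LieSubalgebra ℂ 𝔤 :=
    { carrier := {x | ∀ m ∈ N, ⁅x, m⁆ ∈ N}
      add_mem' := fun {x y} hx hy m hm ↦ by rw [add_lie]; exact add_mem (hx m hm) (hy m hm)
      zero_mem' := fun m hm ↦ by rw [zero_lie]; exact zero_mem _
      smul_mem' := fun c x hx m hm ↦ by rw [smul_lie]; exact N.smul_mem c (hx m hm)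
      lie_mem' := fun {x y} hx hy m hm ↦ by
        rw [lie_lie]
        exact sub_mem (hx _ (hy m hm)) (hy _ (hx m hm)) }
  have hL : ∀ x, x ∈ L := lieSubalgebra_eq_top b L (fun h m hm ↦ hhN m hm h)
    (fun i hi x hx m hm ↦ heN m hm i hi x hx) hyN
  have htop := hgen { N with lie_mem := fun {x m} hm ↦ hL x m hm } hvN
  have htop' : N = ⊤ := congrArg LieSubmodule.toSubmodule htop
  rw [eq_top_iff, ← htop']
  exact sInf_le ⟨hN₁ rfl, hN₁y⟩

/-- Lowering `v` only reaches weights strictly below `μ`, so the module is the span of `v` plus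
weight spaces of other weights. -/
theorem NegGenerates.mem_span_singleton {μ : Module.Dual ℂ 𝔥} {v : M} (hv : IsWeightVec μ v)
    (hA : NegGenerates b {v}) {w : M} (hw : IsWeightVec μ w) : ∃ c : ℂ, w = c • v := by
  let T : Set (Module.Dual ℂ 𝔥) := {l | l ≠ μ ∧ ∃ p ∈ posCone b, l + p = μ}
  have htop := hA (Submodule.span ℂ {v} ⊔ ⨆ l ∈ T, weightSubmodule (𝔤 := 𝔤) M l)
    (fun a ha ↦ Submodule.mem_sup_left (Submodule.subset_span ha)) fun i hi y hy m hm ↦ ?_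
  · have hw' : w ∈ Submodule.span ℂ {v} ⊔ ⨆ l ∈ T, weightSubmodule (𝔤 := 𝔤) M l := htop ▸ trivial
    obtain ⟨a, ha, t, ht, rfl⟩ := Submodule.mem_sup.mp hw'
    obtain ⟨c, rfl⟩ := Submodule.mem_span_singleton.mp ha
    refine ⟨c, ?_⟩
    have htw : IsWeightVec μ t := by
      have := sub_mem (show _ ∈ weightSubmodule (𝔤 := 𝔤) M μ from hw)
        (Submodule.smul_mem (weightSubmodule (𝔤 := 𝔤) M μ) c hv)
      rwa [add_sub_cancel_left] at this
    rw [htw.eq_zero_of_mem_iSup (T := T) (fun h ↦ h.1 rfl) ht, add_zero]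
  · have key : ∀ (l : Module.Dual ℂ 𝔥) (p : Module.Dual ℂ 𝔥) (m : M), p ∈ posCone b →
        l + p = μ → IsWeightVec l m → ⁅y, m⁆ ∈ ⨆ l ∈ T, weightSubmodule (𝔤 := 𝔤) M l := by
      intro l p m hp hl hm
      refine Submodule.mem_iSup_of_mem (l - rootDual i) (Submodule.mem_iSup_of_mem
        ⟨fun h ↦ ?_, p + rootDual i, add_mem hp (root_mem_posCone hi), ?_⟩ (hm.lie_neg_root hy))
      · have h2 : rootDual i + p = 0 := by
          rw [← hl, sub_eq_iff_eq_add] at h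
          have : l + (rootDual i + p) = l + 0 := by rw [add_zero]; nth_rw 2 [h]; abel
          exact add_left_cancel this
        exact (rootSystem 𝔥).ne_zero i
          (eq_zero_of_add_eq_zero_of_mem_posCone (root_mem_posCone hi) hp h2)
      · rw [← hl]; abel
    refine Submodule.mem_sup_right ?_
    obtain ⟨a, ha, t, ht, rfl⟩ := Submodule.mem_sup.mp hm
    rw [lie_add]
    refine add_mem ?_ ?_
    · obtain ⟨c, rfl⟩ := Submodule.mem_span_singleton.mp ha
      rw [lie_smul]
      exact Submodule.smul_mem _ c (key μ 0 v (zero_mem _) (add_zero μ) hv)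
    · clear hm ha
      induction ht using Submodule.iSup_induction' with
      | zero => simp
      | add m n _ _ hm hn => rw [lie_add]; exact add_mem hm hn
      | mem l m hm =>
        induction hm using Submodule.iSup_induction' with
        | zero => simp
        | add m n _ _ hm hn => rw [lie_add]; exact add_mem hm hn
        | mem hl m hm =>
          obtain ⟨-, p, hp, hlp⟩ := hl
          exact key l p m hp hlp hm

end FiniteDimensionalModules

/-! ### Homomorphisms from simple modules -/

section SimpleModules

open LieAlgebra LieAlgebra.IsKilling LieModule

variable {𝔤 : Type u} [LieRing 𝔤] [LieAlgebra ℂ 𝔤] [FiniteDimensional ℂ 𝔤]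
  [LieAlgebra.IsSimple ℂ 𝔤] {𝔥 : LieSubalgebra ℂ 𝔤} [𝔥.IsCartanSubalgebra]
  {M : Type*} [AddCommGroup M] [Module ℂ M] [LieRingModule 𝔤 M] [LieModule ℂ 𝔤 M]
  {b : (rootSystem 𝔥).Base}

theorem exists_isSingular [FiniteDimensional ℂ M] [Nontrivial M] (b : (rootSystem 𝔥).Base) :
    ∃ (ν : Module.Dual ℂ 𝔥) (w : M), w ≠ 0 ∧ IsSingular b ν w := by
  obtain ⟨χ, hχ⟩ := exists_nontrivial_weightSpace_of_isSolvable ℂ 𝔥 M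
  obtain ⟨⟨m, hm⟩, hm0⟩ := exists_ne (0 : weightSpace M χ)
  have hm' : IsWeightVec χ m := (mem_weightSpace (χ : 𝔥 → ℂ) m).mp hm
  obtain ⟨p, -, w, hw0, hw⟩ := hm'.exists_isSingular (fun h ↦ hm0 (Subtype.ext h)) b
  exact ⟨χ + p, w, hw0, hw⟩

namespace SimpleModule

/-- The class of an element of the enveloping algebra in the simple module. -/
def mk (μ : DominantWeight b) : UEnv 𝔤 →ₗ[UEnv 𝔤] SimpleModule μ := (simpleModuleRel μ).mkQ

theorem mk_surjective (μ : DominantWeight b) : Function.Surjective (mk μ) :=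
  (simpleModuleRel μ).mkQ_surjective

theorem lie_mk (μ : DominantWeight b) (x : 𝔤) (u : UEnv 𝔤) :
    ⁅x, mk μ u⁆ = mk μ (UEnv.ι x * u) := rfl

theorem mk_eq_zero (μ : DominantWeight b) {u : UEnv 𝔤} (hu : u ∈ simpleModuleRel μ) :
    mk μ u = 0 := (Submodule.Quotient.mk_eq_zero _).mpr hu

theorem isSingular_mk_one (μ : DominantWeight b) : IsSingular b μ.1 (mk μ 1) := by
  refine ⟨fun h ↦ ?_, fun i hi x hx ↦ ?_⟩
  · have h1 := mk_eq_zero μ (u := UEnv.ι (h : 𝔤) - algebraMap ℂ (UEnv 𝔤) (μ.1 h))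
      (Submodule.subset_span (Or.inl (Or.inl ⟨h, rfl⟩)))
    rw [map_sub, sub_eq_zero] at h1
    rw [lie_mk, mul_one, h1, ← mul_one (algebraMap ℂ (UEnv 𝔤) (μ.1 h)), ← smul_eq_mul, map_smul,
      algebraMap_smul]
  · rw [lie_mk, mul_one]
    exact mk_eq_zero μ (Submodule.subset_span (Or.inl (Or.inr ⟨i, hi, x, hx, rfl⟩)))

theorem eq_top_of_mk_one_mem (μ : DominantWeight b) (N : LieSubmodule ℂ 𝔤 (SimpleModule μ))
    (hN : mk μ 1 ∈ N) : N = ⊤ := by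
  let S : Submodule ℂ (UEnv 𝔤) := N.toSubmodule.comap ((mk μ).restrictScalars ℂ)
  have hS : S = ⊤ := UEnv.eq_top_of_one_mem S hN fun x u hu ↦ by
    change mk μ (UEnv.ι x * u) ∈ N
    rw [← lie_mk]
    exact N.lie_mem hu
  refine eq_top_iff.mpr fun m _ ↦ ?_
  obtain ⟨u, rfl⟩ := mk_surjective μ m
  have : u ∈ S := hS ▸ trivial
  exact this

section

attribute [local instance 100] LieRing.ofAssociativeRing

/-- Finite dimension of the target supplies the nilpotency relations, so the action on `w` factors
through the presentation of V(μ). -/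
theorem exists_hom_of_isSingular [FiniteDimensional ℂ M] (μ : DominantWeight b) {w : M}
    (hw : IsSingular b μ.1 w) : ∃ φ : SimpleModule μ →ₗ⁅ℂ, 𝔤⁆ M, φ (mk μ 1) = w := by
  by_cases hw0 : w = 0
  · exact ⟨0, hw0.symm⟩
  let ρ : UEnv 𝔤 →ₐ[ℂ] Module.End ℂ M := UniversalEnvelopingAlgebra.lift ℂ (toEnd ℂ 𝔤 M)
  have hρ : ∀ x, ρ (UEnv.ι x) = toEnd ℂ 𝔤 M x := fun x ↦
    UniversalEnvelopingAlgebra.lift_ι_apply ℂ (toEnd ℂ 𝔤 M) x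
  let f : UEnv 𝔤 →ₗ[ℂ] M := (LinearMap.applyₗ w).comp ρ.toLinearMap
  have hf : ∀ u, f u = ρ u w := fun u ↦ rfl
  have hker : (simpleModuleRel μ).restrictScalars ℂ ≤ LinearMap.ker f := by
    intro u hu
    rw [LinearMap.mem_ker, hf]
    have hu' : u ∈ simpleModuleRel μ := hu
    clear hu
    induction hu' using Submodule.span_induction with
    | mem u hu =>
      rcases hu with (⟨h, rfl⟩ | ⟨i, hi, x, hx, rfl⟩) | ⟨i, hi, y, hy, n, hn, rfl⟩
      · rw [map_sub, hρ, AlgHom.commutes, LinearMap.sub_apply, toEnd_apply_apply, hw.1 h,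
          Module.algebraMap_end_apply, sub_self]
      · rw [hρ, toEnd_apply_apply, hw.2 i hi x hx]
      · rw [map_pow, hρ]
        obtain ⟨n', hn', h⟩ := hw.exists_apply_coroot_eq hw0 hi
        have : n = n' := by
          rw [rootSystem_coroot_apply, hn'] at hn
          exact_mod_cast hn.symm
        rw [this]
        exact h y hy
    | zero => simp
    | add u v _ _ hu hv => rw [map_add, LinearMap.add_apply, hu, hv, add_zero]
    | smul c u _ hu => rw [smul_eq_mul, map_mul, Module.End.mul_apply, hu, map_zero]
  let g : SimpleModule μ →ₗ[ℂ] M := ((simpleModuleRel μ).restrictScalars ℂ).liftQ f hker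
  have hg : ∀ u, g (mk μ u) = ρ u w := fun u ↦ rfl
  refine ⟨{ g with map_lie' := fun {x m} ↦ ?_ }, ?_⟩
  · obtain ⟨u, rfl⟩ := mk_surjective μ m
    change g ⁅x, mk μ u⁆ = ⁅x, g (mk μ u)⁆
    rw [lie_mk, hg, hg, map_mul, hρ]
    rfl
  · change g (mk μ 1) = w
    rw [hg, map_one]
    rfl

end

theorem hom_eq_zero_of_mk_one (μ : DominantWeight b) (φ : SimpleModule μ →ₗ⁅ℂ, 𝔤⁆ M)
    (h : φ (mk μ 1) = 0) : φ = 0 := by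
  have := eq_top_of_mk_one_mem μ φ.ker (by simpa using h)
  ext m
  have hm : m ∈ φ.ker := this ▸ LieSubmodule.mem_top m
  simpa using hm

/-- The simple module has at most one proper submodule of finite codimension. -/
theorem le_of_finiteDimensional_quotient (μ : DominantWeight b)
    (N₁ N₂ : LieSubmodule ℂ 𝔤 (SimpleModule μ)) [FiniteDimensional ℂ (SimpleModule μ ⧸ N₁)]
    [FiniteDimensional ℂ (SimpleModule μ ⧸ N₂)] (h₁ : N₁ ≠ ⊤) : N₁ ≤ N₂ := by
  -- The quotient by `N` is finite-dimensional and generated by a singular vector of weight μ. A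
  -- nonzero image of `N₁` in it contains a singular vector, whose weight must be μ and which is
  -- thus proportional to the generator; then `N₁` is everything. Neither finite dimension nor
  -- simplicity of V(μ) enters.
  let N := N₁ ⊓ N₂
  let π := LieSubmodule.Quotient.mk' N
  have hπ : Function.Surjective π := LieSubmodule.Quotient.surjective_mk' N
  have hπ0 : ∀ m, π m = 0 ↔ m ∈ N := fun m ↦ LieSubmodule.Quotient.mk_eq_zero'
  have hfd : FiniteDimensional ℂ (SimpleModule μ ⧸ N) := by
    let f : SimpleModule μ →ₗ[ℂ] (SimpleModule μ ⧸ N₁) × (SimpleModule μ ⧸ N₂) :=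
      (LieSubmodule.Quotient.mk' N₁ : _ →ₗ[ℂ] _).prod (LieSubmodule.Quotient.mk' N₂ : _ →ₗ[ℂ] _)
    have hker : LinearMap.ker f = N.toSubmodule := by
      ext m
      rw [LinearMap.mem_ker]
      constructor
      · intro h
        have h1 : LieSubmodule.Quotient.mk' N₁ m = 0 := congrArg Prod.fst h
        have h2 : LieSubmodule.Quotient.mk' N₂ m = 0 := congrArg Prod.snd h
        exact ⟨LieSubmodule.Quotient.mk_eq_zero'.mp h1, LieSubmodule.Quotient.mk_eq_zero'.mp h2⟩
      · rintro ⟨h1, h2⟩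
        exact Prod.ext (LieSubmodule.Quotient.mk_eq_zero'.mpr h1)
          (LieSubmodule.Quotient.mk_eq_zero'.mpr h2)
    have : FiniteDimensional ℂ (SimpleModule μ ⧸ LinearMap.ker f) :=
      Module.Finite.equiv f.quotKerEquivRange.symm
    rw [hker] at this
    exact this
  by_contra hle
  have hsing := (isSingular_mk_one μ).map π
  have hgen : NegGenerates b {π (mk μ 1)} := by
    refine hsing.negGenerates fun S hS ↦ ?_
    have := eq_top_of_mk_one_mem μ (S.comap π) hS
    refine eq_top_iff.mpr fun m _ ↦ ?_
    obtain ⟨m, rfl⟩ := hπ m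
    have hm : m ∈ S.comap π := this ▸ LieSubmodule.mem_top m
    exact hm
  let I := N₁.map π
  obtain ⟨m, hm, hm2⟩ := SetLike.not_le_iff_exists.mp hle
  have hmN : π m ≠ 0 := fun h ↦ hm2 ((hπ0 m).mp h).2
  have hnt : Nontrivial I :=
    ⟨⟨⟨π m, LieSubmodule.mem_map_of_mem hm⟩, 0, fun h ↦ hmN (congrArg Subtype.val h)⟩⟩
  obtain ⟨ν, w, hw0, hw⟩ := exists_isSingular (M := I) b
  have hw' := hw.map I.incl
  have hw0' : I.incl w ≠ 0 := fun h ↦ hw0 (Subtype.ext h)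
  obtain ⟨_, rfl, ha0, ha⟩ := hgen.exists_weight_eq
    (fun a ha ↦ ⟨μ.1, by rw [Set.mem_singleton_iff.mp ha]; exact hsing.1⟩) hw' hw0'
  have hν := ha.eq_of_ne_zero hsing.1 ha0
  rw [hν] at hw'
  obtain ⟨c, hc⟩ := hgen.mem_span_singleton hsing.1 hw'.1
  have hc0 : c ≠ 0 := fun h ↦ hw0' (by rw [hc, h, zero_smul])
  have hmem : π (mk μ 1) ∈ I := by
    have h1 : c • π (mk μ 1) ∈ I := hc ▸ w.2
    have := I.smul_mem c⁻¹ h1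
    rwa [smul_smul, inv_mul_cancel₀ hc0, one_smul] at this
  obtain ⟨n, hn, hnπ⟩ := (LieSubmodule.mem_map _).mp hmem
  have hsub : n - mk μ 1 ∈ N := (hπ0 _).mp (by rw [map_sub, hnπ, sub_self])
  refine h₁ (eq_top_of_mk_one_mem μ N₁ ?_)
  have := sub_mem hn hsub.1
  rwa [sub_sub_cancel] at this

end SimpleModule

end SimpleModules

/-! ### Graded modules: singular vectors, shifts and truncations -/

section Graded

variable {𝔤 : Type u} [LieRing 𝔤] [LieAlgebra ℂ 𝔤]

theorem AdExt.inl_lie_ad (x y : 𝔤) : ⁅AdExt.inl x, AdExt.ad y⁆ = AdExt.ad ⁅x, y⁆ := by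
  ext
  · exact lie_zero x
  · change ⁅x, y⁆ + ⁅(0 : 𝔤), (0 : 𝔤)⁆ = ⁅x, y⁆
    rw [lie_zero, add_zero]

namespace GradedLieMod

/-- A graded `𝔤 ⋉ 𝔤_ad`-module is a `𝔤`-module. -/
instance (V : GradedLieMod 𝔤) : LieRingModule 𝔤 V.carrier :=
  LieRingModule.compLieHom V.carrier AdExt.inl

instance (V : GradedLieMod 𝔤) : LieModule ℂ 𝔤 V.carrier :=
  LieModule.compLieHom V.carrier AdExt.inl

theorem lie_eq_inl_lie (V : GradedLieMod 𝔤) (x : 𝔤) (m : V.carrier) :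
    ⁅x, m⁆ = ⁅AdExt.inl x, m⁆ := rfl

theorem lie_ad_lie (V : GradedLieMod 𝔤) (x y : 𝔤) (m : V.carrier) :
    ⁅x, ⁅AdExt.ad y, m⁆⁆ = ⁅AdExt.ad ⁅x, y⁆, m⁆ + ⁅AdExt.ad y, ⁅x, m⁆⁆ := by
  rw [lie_eq_inl_lie, leibniz_lie, AdExt.inl_lie_ad]
  rfl

/-- The inclusion of a graded piece, as a homomorphism of `𝔤`-modules. -/
def grIncl (V : GradedLieMod 𝔤) (k : ℕ) : V.gr k →ₗ⁅ℂ, 𝔤⁆ V.carrier where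
  __ := (V.gr k).subtype
  map_lie' := rfl

theorem iSup_gr (V : GradedLieMod 𝔤) : ⨆ k, V.gr k = ⊤ :=
  V.isInternal.submodule_iSup_eq_top

theorem proj_shiftObj (r : ℕ) (V : GradedLieMod 𝔤) (k : ℕ) (v : V.carrier) :
    (shiftObj r V).proj k v = if r ≤ k then V.proj (k - r) v else 0 := by
  have hv : v ∈ ⨆ k, V.gr k := V.iSup_gr ▸ trivial
  induction hv using Submodule.iSup_induction' with
  | mem j v hv =>
    have hv' : v ∈ (shiftObj r V).gr (j + r) := by
      change v ∈ if r ≤ j + r then V.gr (j + r - r) else ⊥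
      rwa [if_pos (Nat.le_add_left r j), Nat.add_sub_cancel]
    by_cases hk : j + r = k
    · subst hk
      rw [if_pos (Nat.le_add_left r j), Nat.add_sub_cancel, V.proj_of_mem hv]
      exact (shiftObj r V).proj_of_mem hv'
    · have h1 : (shiftObj r V).proj k v = 0 := (shiftObj r V).proj_of_mem_ne hv' hk
      rw [h1]
      split_ifs with h
      · rw [V.proj_of_mem_ne hv (by omega)]
        rfl
      · rfl
  | zero =>
    have h0 : ∀ (W : GradedLieMod 𝔤) (k : ℕ), W.proj k 0 = 0 := fun W k ↦
      W.proj_of_mem_ne (k := k + 1) (Submodule.zero_mem _) (by omega)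
    have h1 : (shiftObj r V).proj k (0 : V.carrier) = 0 := h0 (shiftObj r V) k
    rw [h1, h0, ite_self]
    rfl
  | add v w _ _ hv hw =>
    have h1 : (shiftObj r V).proj k (v + w) =
      (shiftObj r V).proj k v + (shiftObj r V).proj k w := (shiftObj r V).proj_add k v w
    rw [h1, hv, hw, V.proj_add]
    split_ifs
    · rfl
    · exact add_zero _

theorem isGraded_shiftObj (r : ℕ) (V : GradedLieMod 𝔤)
    (K : LieSubmodule ℂ (AdExt 𝔤) V.carrier) : (shiftObj r V).IsGraded K ↔ V.IsGraded K := by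
  constructor
  · intro h v hv k
    have h1 : (shiftObj r V).proj (k + r) v ∈ K := h v hv (k + r)
    rwa [proj_shiftObj, if_pos (Nat.le_add_left r k), Nat.add_sub_cancel] at h1
  · intro h v hv k
    have h1 : ∀ z : V.carrier, (z = if r ≤ k then V.proj (k - r) v else 0) → z ∈ K := by
      rintro z rfl
      split_ifs
      · exact h v hv _
      · exact zero_mem K
    exact h1 _ (proj_shiftObj r V k v)

/-- Shifts keep the carrier, so the compatibilities of shifts with quotients and with P(μ, r) hold
as equalities of objects once the families of graded pieces agree. -/
theorem mk_eq_mk (W : GradedLieMod 𝔤) {gr gr' : ℕ → Submodule ℂ W.carrier} (h : gr = gr')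
    (h₁ h₂ h₃ h₁' h₂' h₃') : (⟨W.carrier, gr, h₁, h₂, h₃⟩ : GradedLieMod 𝔤) =
      ⟨W.carrier, gr', h₁', h₂', h₃'⟩ := by
  subst h; rfl

theorem quotient_shiftObj (r : ℕ) (V : GradedLieMod 𝔤)
    (K : LieSubmodule ℂ (AdExt 𝔤) V.carrier) (hK : (shiftObj r V).IsGraded K) :
    (shiftObj r V).quotient K hK =
      shiftObj r (V.quotient K ((isGraded_shiftObj r V K).mp hK)) := by
  have key : ∀ k, Submodule.map (LieSubmodule.Quotient.mk' K : V.carrier →ₗ[ℂ] V.carrier ⧸ K)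
      (if r ≤ k then V.gr (k - r) else ⊥) = if r ≤ k then Submodule.map
        (LieSubmodule.Quotient.mk' K : V.carrier →ₗ[ℂ] V.carrier ⧸ K) (V.gr (k - r)) else ⊥ := by
    intro k
    split_ifs
    · rfl
    · exact Submodule.map_bot _
  exact mk_eq_mk (V.quotient K ((isGraded_shiftObj r V K).mp hK)) (funext key) _ _ _ _ _ _

theorem quotient_congr (V : GradedLieMod 𝔤) {K K' : LieSubmodule ℂ (AdExt 𝔤) V.carrier}
    (h : K = K') (hK : V.IsGraded K) (hK' : V.IsGraded K') :
    V.quotient K hK = V.quotient K' hK' := by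
  subst h; rfl

/-- The projection onto a quotient, as a homomorphism of `𝔤`-modules. -/
def quotientMap (V : GradedLieMod 𝔤) (K : LieSubmodule ℂ (AdExt 𝔤) V.carrier)
    (hK : V.IsGraded K) : V.carrier →ₗ⁅ℂ, 𝔤⁆ (V.quotient K hK).carrier where
  __ := (LieSubmodule.Quotient.mk' K : V.carrier →ₗ[ℂ] V.carrier ⧸ K)
  map_lie' := fun {x m} ↦ LieModuleHom.map_lie (LieSubmodule.Quotient.mk' K) (AdExt.inl x) m

theorem quotientMap_eq_zero (V : GradedLieMod 𝔤) (K : LieSubmodule ℂ (AdExt 𝔤) V.carrier)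
    (hK : V.IsGraded K) (m : V.carrier) : V.quotientMap K hK m = 0 ↔ m ∈ K :=
  LieSubmodule.Quotient.mk_eq_zero'

theorem quotientMap_lie (V : GradedLieMod 𝔤) (K : LieSubmodule ℂ (AdExt 𝔤) V.carrier)
    (hK : V.IsGraded K) (x : AdExt 𝔤) (m : V.carrier) :
    V.quotientMap K hK ⁅x, m⁆ = ⁅x, V.quotientMap K hK m⁆ :=
  LieModuleHom.map_lie (LieSubmodule.Quotient.mk' K) x m

theorem mem_gr_quotient (V : GradedLieMod 𝔤) (K : LieSubmodule ℂ (AdExt 𝔤) V.carrier)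
    (hK : V.IsGraded K) (k : ℕ) (m : (V.quotient K hK).carrier) :
    m ∈ (V.quotient K hK).gr k ↔ ∃ v ∈ V.gr k, V.quotientMap K hK v = m := Iff.rfl

end GradedLieMod

end Graded

/-! ### Truncations: detection by singular vectors, compatibility with shifts -/

section Truncation

open LieAlgebra LieAlgebra.IsKilling LieModule GradedLieMod

variable {𝔤 : Type u} [LieRing 𝔤] [LieAlgebra ℂ 𝔤] [FiniteDimensional ℂ 𝔤]
  [LieAlgebra.IsSimple ℂ 𝔤] {𝔥 : LieSubalgebra ℂ 𝔤} [𝔥.IsCartanSubalgebra]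
  {b : (rootSystem 𝔥).Base}

theorem isSingular_gr_iff {V : GradedLieMod 𝔤} {k : ℕ} {ν : Module.Dual ℂ 𝔥} {w : V.gr k} :
    IsSingular b ν (w : V.carrier) ↔ IsSingular b ν w :=
  ⟨fun h ↦ ⟨fun t ↦ Subtype.ext (h.1 t), fun i hi x hx ↦ Subtype.ext (h.2 i hi x hx)⟩,
    fun h ↦ h.map (V.grIncl k)⟩

theorem exists_isSingular_of_simpleMultiplicity {V : GradedLieMod 𝔤} {p : DominantWeight b × ℕ}
    (h : simpleMultiplicity V p ≠ 0) :
    ∃ w ∈ V.gr p.2, w ≠ 0 ∧ IsSingular b p.1.1 (w : V.carrier) := by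
  have hnt : Nontrivial (SimpleModule p.1 →ₗ⁅ℂ, 𝔤⁆ V.gr p.2) := by
    by_contra hn
    rw [not_nontrivial_iff_subsingleton] at hn
    exact h (rank_subsingleton' ℂ _)
  obtain ⟨φ, hφ⟩ := exists_ne (0 : SimpleModule p.1 →ₗ⁅ℂ, 𝔤⁆ V.gr p.2)
  refine ⟨φ (SimpleModule.mk p.1 1), (φ (SimpleModule.mk p.1 1)).2, fun h0 ↦ hφ ?_,
    isSingular_gr_iff.mpr ((SimpleModule.isSingular_mk_one p.1).map φ)⟩
  exact SimpleModule.hom_eq_zero_of_mk_one p.1 φ (Subtype.ext h0)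

theorem simpleMultiplicity_ne_zero {V : GradedLieMod 𝔤} (p : DominantWeight b × ℕ)
    [FiniteDimensional ℂ (V.gr p.2)] {w : V.carrier} (hw : w ∈ V.gr p.2) (hw0 : w ≠ 0)
    (hs : IsSingular b p.1.1 w) : simpleMultiplicity V p ≠ 0 := by
  obtain ⟨φ, hφ⟩ := SimpleModule.exists_hom_of_isSingular p.1
    (isSingular_gr_iff.mp hs : IsSingular b p.1.1 (⟨w, hw⟩ : V.gr p.2))
  have hφ0 : φ ≠ 0 := by
    rintro rfl
    exact hw0 (congrArg Subtype.val hφ).symm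
  have hnt : Nontrivial (SimpleModule p.1 →ₗ⁅ℂ, 𝔤⁆ V.gr p.2) := ⟨φ, 0, hφ0⟩
  exact rank_pos.ne'

/-- When the pieces are finite-dimensional, nonzero homomorphisms from V(ν) correspond to nonzero
singular vectors of weight ν. From here on multiplicities are replaced by singular vectors. -/
theorem g2Gamma_iff {Γ : Set (DominantWeight b × ℕ)} {V : GradedLieMod 𝔤} :
    G2Gamma Γ V ↔ GradedLieMod.G2 V ∧ ∀ (ν : DominantWeight b) (s : ℕ), ∀ w ∈ V.gr s, w ≠ 0 →
      IsSingular b ν.1 (w : V.carrier) → (ν, s) ∈ Γ := by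
  refine and_congr_right fun hfd ↦ ⟨fun h ν s w hw hw0 hs ↦ ?_, fun h p hp ↦ ?_⟩
  · have := hfd s
    exact h (ν, s) (simpleMultiplicity_ne_zero (ν, s) hw hw0 hs)
  · obtain ⟨w, hw, hw0, hs⟩ := exists_isSingular_of_simpleMultiplicity hp
    exact h p.1 p.2 w hw hw0 hs

/-- The set of the pairs `(ν, s)` with `(ν, s + r) ∈ Γ`. -/
def shiftDown (r : ℕ) (Γ : Set (DominantWeight b × ℕ)) : Set (DominantWeight b × ℕ) :=
  {p | (p.1, p.2 + r) ∈ Γ}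

theorem g2Gamma_shiftObj (r : ℕ) (Γ : Set (DominantWeight b × ℕ)) (V : GradedLieMod 𝔤) :
    G2Gamma Γ (shiftObj r V) ↔ G2Gamma (shiftDown r Γ) V := by
  have hgr : ∀ k, (shiftObj r V).gr (k + r) = V.gr k := by
    intro k
    change (if r ≤ k + r then V.gr (k + r - r) else ⊥) = V.gr k
    rw [if_pos (Nat.le_add_left r k), Nat.add_sub_cancel]
  have hgr' : ∀ k, k < r → (shiftObj r V).gr k = ⊥ := fun k hk ↦ if_neg (by omega)
  rw [g2Gamma_iff, g2Gamma_iff]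
  refine and_congr ⟨fun h k ↦ ?_, fun h k ↦ ?_⟩
    ⟨fun h ν s w hw hw0 hs ↦ ?_, fun h ν s w hw hw0 hs ↦ ?_⟩
  · have := h (k + r)
    rw [hgr] at this
    exact this
  · by_cases hk : k < r
    · rw [hgr' k hk]
      exact Module.Finite.bot ℂ _
    · obtain ⟨j, rfl⟩ := Nat.exists_eq_add_of_le' (not_lt.mp hk)
      rw [hgr]
      exact h j
  · exact h ν (s + r) w ((hgr s).symm ▸ hw) hw0 hs
  · by_cases hk : s < r
    · rw [hgr' s hk] at hw
      exact absurd hw hw0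
    · obtain ⟨j, rfl⟩ := Nat.exists_eq_add_of_le' (not_lt.mp hk)
      rw [hgr] at hw
      exact h ν j w hw hw0 hs

theorem truncationKernels_shiftObj (r : ℕ) (Γ : Set (DominantWeight b × ℕ)) (V : GradedLieMod 𝔤) :
    truncationKernels Γ (shiftObj r V) = truncationKernels (shiftDown r Γ) V := by
  ext K
  constructor
  · rintro ⟨hK, h⟩
    refine ⟨(isGraded_shiftObj r V K).mp hK, ?_⟩
    rw [← g2Gamma_shiftObj]
    exact quotient_shiftObj r V K hK ▸ h
  · rintro ⟨hK, h⟩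
    refine ⟨(isGraded_shiftObj r V K).mpr hK, ?_⟩
    have := quotient_shiftObj r V K ((isGraded_shiftObj r V K).mpr hK)
    rw [this, g2Gamma_shiftObj]
    exact h

theorem truncation_shiftObj (r : ℕ) (Γ : Set (DominantWeight b × ℕ)) (V : GradedLieMod 𝔤) :
    truncation Γ (shiftObj r V) = shiftObj r (truncation (shiftDown r Γ) V) := by
  have hK : sInf (truncationKernels Γ (shiftObj r V)) =
      sInf (truncationKernels (shiftDown r Γ) V) :=
    congrArg sInf (truncationKernels_shiftObj r Γ V)
  have hg := V.isGraded_sInf (truncationKernels (shiftDown r Γ) V) fun _ hK ↦ hK.1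
  exact (quotient_congr (shiftObj r V) hK _ ((isGraded_shiftObj r V _).mpr hg)).trans
    (quotient_shiftObj r V _ _)

/-- A nonzero singular vector modulo the intersection stays nonzero modulo some member K of the
family, and it stays singular there, so its weight and degree lie in Γ. Finite dimension need not
pass to an infinite intersection, which is why it is a hypothesis. -/
theorem g2Gamma_truncation (Γ : Set (DominantWeight b × ℕ)) (V : GradedLieMod 𝔤)
    (hfd : G2 (truncation Γ V)) : G2Gamma Γ (truncation Γ V) := by
  rw [g2Gamma_iff]
  refine ⟨hfd, ?_⟩
  rintro ν s _ ⟨m, hm, rfl⟩ hw0 hs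
  have hg := V.isGraded_sInf (truncationKernels Γ V) fun _ hK ↦ hK.1
  have hmem : m ∉ sInf (truncationKernels Γ V) := fun h ↦
    hw0 ((V.quotientMap_eq_zero _ hg m).mpr h)
  obtain ⟨K, hK, hmK⟩ : ∃ K ∈ truncationKernels Γ V, m ∉ K := by
    by_contra! h
    refine hmem ?_
    rw [← SetLike.mem_coe, LieSubmodule.coe_sInf, Set.mem_iInter₂]
    exact h
  obtain ⟨hKg, hKG⟩ := hK
  refine (g2Gamma_iff.mp hKG).2 ν s (V.quotientMap K hKg m) ⟨m, hm, rfl⟩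
    (fun h ↦ hmK ((V.quotientMap_eq_zero K hKg m).mp h)) ?_
  have hle : sInf (truncationKernels Γ V) ≤ K := sInf_le ⟨hKg, hKG⟩
  have hs' : IsSingular b ν.1 (V.quotientMap _ hg m) := hs
  refine ⟨fun t ↦ ?_, fun i hi x hx ↦ ?_⟩
  · have h1 : ⁅(t : 𝔤), m⁆ - ν.1 t • m ∈ sInf (truncationKernels Γ V) := by
      rw [← V.quotientMap_eq_zero _ hg, map_sub, map_smul, LieModuleHom.map_lie, hs'.1 t, sub_self]
    have h2 := (V.quotientMap_eq_zero K hKg _).mpr (hle h1)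
    rwa [map_sub, map_smul, LieModuleHom.map_lie, sub_eq_zero] at h2
  · have h1 : ⁅x, m⁆ ∈ sInf (truncationKernels Γ V) := by
      rw [← V.quotientMap_eq_zero _ hg, LieModuleHom.map_lie, hs'.2 i hi x hx]
    have h2 := (V.quotientMap_eq_zero K hKg _).mpr (hle h1)
    rwa [LieModuleHom.map_lie] at h2

end Truncation

/-! ### The modules `P(μ, r)` -/

section Projective

open LieAlgebra LieAlgebra.IsKilling LieModule GradedLieMod

section

variable {𝔤 : Type u} [LieRing 𝔤] [LieAlgebra ℂ 𝔤]

/-- A graded module is generated by an element of degree zero. -/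
structure IsGradedGenerator (Q : GradedLieMod 𝔤) (v : Q.carrier) : Prop where
  mem : v ∈ Q.gr 0
  gr_zero_le : ∀ N : Submodule ℂ Q.carrier, v ∈ N → (∀ x : 𝔤, ∀ m ∈ N, ⁅x, m⁆ ∈ N) → Q.gr 0 ≤ N
  gr_succ_le : ∀ (k : ℕ) (N : Submodule ℂ Q.carrier),
    (∀ x : 𝔤, ∀ m ∈ Q.gr k, ⁅AdExt.ad x, m⁆ ∈ N) → Q.gr (k + 1) ≤ N

/-- Generation is phrased through arbitrary subspaces, so it passes to a quotient by pulling
subspaces back. -/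
theorem IsGradedGenerator.quotient {V : GradedLieMod 𝔤} {v : V.carrier}
    (h : IsGradedGenerator V v) (K : LieSubmodule ℂ (AdExt 𝔤) V.carrier) (hK : V.IsGraded K) :
    IsGradedGenerator (V.quotient K hK) (V.quotientMap K hK v) := by
  refine ⟨⟨v, h.mem, rfl⟩, ?_, ?_⟩
  · rintro N hv hN _ ⟨m, hm, rfl⟩
    refine h.gr_zero_le (N.comap (V.quotientMap K hK).toLinearMap) hv
      (fun x m hm ↦ ?_) hm
    change V.quotientMap K hK ⁅x, m⁆ ∈ N
    rw [LieModuleHom.map_lie]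
    exact hN x _ hm
  · rintro k N hN _ ⟨m, hm, rfl⟩
    refine h.gr_succ_le k (N.comap (V.quotientMap K hK).toLinearMap)
      (fun x m hm ↦ ?_) hm
    change V.quotientMap K hK ⁅AdExt.ad x, m⁆ ∈ N
    rw [V.quotientMap_lie]
    exact hN x _ ⟨m, hm, rfl⟩

/-- Each piece is contained in the image of 𝔤 tensored with the preceding piece, so finite dimension
spreads from degree zero. -/
theorem IsGradedGenerator.g2 {Q : GradedLieMod 𝔤} {v : Q.carrier} (h : IsGradedGenerator Q v)
    [FiniteDimensional ℂ 𝔤] (h0 : FiniteDimensional ℂ (Q.gr 0)) : G2 Q := by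
  intro k
  induction k with
  | zero => exact h0
  | succ k ih =>
    let B : 𝔤 →ₗ[ℂ] Q.carrier →ₗ[ℂ] Q.carrier :=
      (toEnd ℂ (AdExt 𝔤) Q.carrier : AdExt 𝔤 →ₗ[ℂ] _).comp AdExt.ad
    have hfg : (Submodule.map₂ B ⊤ (Q.gr k)).FG :=
      Submodule.FG.map₂ B Module.Finite.fg_top (Module.Finite.iff_fg.mp ih)
    have hfd := Module.Finite.iff_fg.mpr hfg
    exact Submodule.finiteDimensional_of_le (h.gr_succ_le k (Submodule.map₂ B ⊤ (Q.gr k))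
      fun x m hm ↦ Submodule.apply_mem_map₂ B trivial hm)

theorem Induced.piece_add (V : Type u) [AddCommGroup V] [Module ℂ V] [Module (UEnv 𝔤) V]
    [IsScalarTower ℂ (UEnv 𝔤) V] (r : ℕ) :
    Induced.piece (𝔤 := 𝔤) V r = fun k ↦ if r ≤ k then Induced.piece V 0 (k - r) else ⊥ := by
  funext k
  split_ifs with hk
  · obtain ⟨j, rfl⟩ := Nat.exists_eq_add_of_le hk
    simp only [Induced.piece, add_right_inj, Nat.add_sub_cancel_left, zero_add]
  · rw [Induced.piece, Submodule.span_eq_bot]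
    rintro _ ⟨a, u, v, h, _⟩
    omega

theorem Induced.piece_le {V : Type u} [AddCommGroup V] [Module ℂ V] [Module (UEnv 𝔤) V]
    [IsScalarTower ℂ (UEnv 𝔤) V] {r k : ℕ} {S : Submodule ℂ (Induced (𝔤 := 𝔤) V)}
    (h : ∀ (a : ℕ) (u : UEnv (AdExt 𝔤)) (v : V), r + a = k → IsMonomial a u → tmul u v ∈ S) :
    Induced.piece V r k ≤ S := by
  refine Submodule.span_le.mpr ?_
  rintro _ ⟨a, u, v, ha, hu, rfl⟩
  exact h a u v ha hu

theorem Induced.tmul_mem_piece {V : Type u} [AddCommGroup V] [Module ℂ V] [Module (UEnv 𝔤) V]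
    [IsScalarTower ℂ (UEnv 𝔤) V] {r k a : ℕ} {u : UEnv (AdExt 𝔤)} (v : V) (h : r + a = k)
    (hu : IsMonomial a u) : tmul u v ∈ Induced.piece V r k :=
  Submodule.subset_span ⟨a, u, v, h, hu, rfl⟩

theorem Induced.tmul_map_inl (V : Type u) [AddCommGroup V] [Module ℂ V] [Module (UEnv 𝔤) V]
    [IsScalarTower ℂ (UEnv 𝔤) V] (a : UEnv 𝔤) (w : V) :
    Induced.tmul (UEnv.map AdExt.inl a) w = Induced.tmul 1 (a • w) := by
  have h : (UEnv.map (AdExt.inl (𝔤 := 𝔤)) a) ⊗ₜ[ℂ] w - 1 ⊗ₜ[ℂ] (a • w) ∈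
      balancedRel (𝔤 := 𝔤) V := Submodule.subset_span ⟨1, a, w, by rw [one_mul]⟩
  have := (Submodule.Quotient.mk_eq_zero (balancedRel (𝔤 := 𝔤) V)).mpr h
  rw [Submodule.Quotient.mk_sub, sub_eq_zero] at this
  exact this

theorem Induced.inl_lie_tmul_one (V : Type u) [AddCommGroup V] [Module ℂ V] [Module (UEnv 𝔤) V]
    [IsScalarTower ℂ (UEnv 𝔤) V] (x : 𝔤) (w : V) :
    ⁅AdExt.inl x, (Induced.tmul 1 w : Induced (𝔤 := 𝔤) V)⁆ = Induced.tmul 1 (UEnv.ι x • w) := by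
  rw [Induced.lie_tmul, mul_one, ← UEnv.map_ι, Induced.tmul_map_inl]

theorem IsMonomial.exists_eq_map_inl {k : ℕ} {u : UEnv (AdExt 𝔤)} (hu : IsMonomial k u)
    (hk : k = 0) : ∃ a : UEnv 𝔤, u = UEnv.map AdExt.inl a := by
  induction hu with
  | one => exact ⟨1, (map_one _).symm⟩
  | inl_mul x _ ih =>
    obtain ⟨a, rfl⟩ := ih hk
    exact ⟨UEnv.ι x * a, by rw [map_mul, UEnv.map_ι]⟩
  | ad_mul x _ _ => omega

end

variable {𝔤 : Type u} [LieRing 𝔤] [LieAlgebra ℂ 𝔤] [FiniteDimensional ℂ 𝔤]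
  [LieAlgebra.IsSimple ℂ 𝔤] {𝔥 : LieSubalgebra ℂ 𝔤} [𝔥.IsCartanSubalgebra]
  {b : (rootSystem 𝔥).Base}

theorem projectiveModule_eq_shiftObj (μ : DominantWeight b) (r : ℕ) :
    projectiveModule μ r = shiftObj r (projectiveModule μ 0) :=
  mk_eq_mk (projectiveModule μ 0) (Induced.piece_add (SimpleModule μ) r) _ _ _ _ _ _

/-- The embedding of `V(μ)` as the degree zero part of `P(μ, 0)`. -/
def toProjective (μ : DominantWeight b) :
    SimpleModule μ →ₗ⁅ℂ, 𝔤⁆ (projectiveModule μ 0).carrier where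
  __ := (Induced.tmulₗ (𝔤 := 𝔤) (SimpleModule μ)).comp
    (TensorProduct.mk ℂ (UEnv (AdExt 𝔤)) (SimpleModule μ) 1)
  map_lie' := fun {x w} ↦ (Induced.inl_lie_tmul_one (SimpleModule μ) x w).symm

theorem mem_gr_zero_projectiveModule (μ : DominantWeight b) (m : (projectiveModule μ 0).carrier) :
    m ∈ (projectiveModule μ 0).gr 0 ↔ ∃ w, toProjective μ w = m := by
  constructor
  · intro hm
    have hle : (projectiveModule μ 0).gr 0 ≤
        LinearMap.range (toProjective μ).toLinearMap := by
      refine Induced.piece_le (V := SimpleModule μ) fun a u w ha hu ↦ ?_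
      obtain ⟨c, rfl⟩ := hu.exists_eq_map_inl (by omega)
      exact ⟨c • w, (Induced.tmul_map_inl (SimpleModule μ) c w).symm⟩
    exact hle hm
  · rintro ⟨w, rfl⟩
    exact Induced.tmul_mem_piece w rfl IsMonomial.one

theorem isGradedGenerator_projectiveModule (μ : DominantWeight b) :
    IsGradedGenerator (projectiveModule μ 0) (toProjective μ (SimpleModule.mk μ 1)) := by
  refine ⟨(mem_gr_zero_projectiveModule μ _).mpr ⟨_, rfl⟩, fun N hv hN m hm ↦ ?_,
    fun k N hN ↦ ?_⟩
  · obtain ⟨w, rfl⟩ := (mem_gr_zero_projectiveModule μ m).mp hm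
    let S : LieSubmodule ℂ 𝔤 (SimpleModule μ) :=
      { N.comap (toProjective μ).toLinearMap with
        lie_mem := fun {x m} hm ↦ by
          change toProjective μ ⁅x, m⁆ ∈ N
          rw [LieModuleHom.map_lie]
          exact hN x _ hm }
    have hS : S = ⊤ := SimpleModule.eq_top_of_mk_one_mem μ S hv
    have : w ∈ S := hS ▸ LieSubmodule.mem_top w
    exact this
  -- `T` is stable under 𝔤 because brackets of 𝔤 with 𝔤_ad stay in 𝔤_ad. A monomial with `k + 1`
  -- factors from 𝔤_ad therefore lies in `T`, even when its leading factors come from 𝔤.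
  · let T : Submodule ℂ (projectiveModule μ 0).carrier := Submodule.span ℂ
      {t | ∃ x : 𝔤, ∃ m ∈ (projectiveModule μ 0).gr k, t = ⁅AdExt.ad x, m⁆}
    have hTN : T ≤ N := by
      refine Submodule.span_le.mpr ?_
      rintro _ ⟨x, m, hm, rfl⟩
      exact hN x m hm
    have hT : ∀ x : 𝔤, ∀ t ∈ T, ⁅x, t⁆ ∈ T := by
      intro x t ht
      induction ht using Submodule.span_induction with
      | mem t ht =>
        obtain ⟨y, m, hm, rfl⟩ := ht
        rw [lie_ad_lie]
        exact add_mem (Submodule.subset_span ⟨_, m, hm, rfl⟩)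
          (Submodule.subset_span ⟨y, _, (projectiveModule μ 0).inl_lie_mem x k m hm, rfl⟩)
      | zero => rw [lie_zero]; exact zero_mem _
      | add s t _ _ hs ht => rw [lie_add]; exact add_mem hs ht
      | smul c t _ ht => rw [lie_smul]; exact T.smul_mem c ht
    have key : ∀ (w : SimpleModule μ) (j : ℕ) (u : UEnv (AdExt 𝔤)), IsMonomial j u → j = k + 1 →
        (Induced.tmul u w : (projectiveModule μ 0).carrier) ∈ T := by
      intro w j u hu
      induction hu with
      | one => intro h; omega
      | inl_mul x _ ih => exact fun h ↦ hT x _ (ih h)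
      | @ad_mul x j u hu _ =>
        intro h
        obtain rfl : j = k := by omega
        exact Submodule.subset_span
          ⟨x, _, Induced.tmul_mem_piece w (zero_add j) hu, rfl⟩
    exact (Induced.piece_le (V := SimpleModule μ) (S := T)
      fun a u w ha hu ↦ key w a u hu (by omega)).trans hTN

/-- The degree zero part of a quotient of `P(μ, 0)`, as a quotient of `V(μ)`. -/
theorem finiteDimensional_gr_zero_iff (μ : DominantWeight b)
    (K : LieSubmodule ℂ (AdExt 𝔤) (projectiveModule μ 0).carrier)
    (hK : (projectiveModule μ 0).IsGraded K) :
    FiniteDimensional ℂ (((projectiveModule μ 0).quotient K hK).gr 0) ↔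
      FiniteDimensional ℂ (SimpleModule μ ⧸
        (((projectiveModule μ 0).quotientMap K hK).comp (toProjective μ)).ker) := by
  set f := ((projectiveModule μ 0).quotientMap K hK).comp (toProjective μ) with hf
  have hrange : ((projectiveModule μ 0).quotient K hK).gr 0 =
      LinearMap.range f.toLinearMap := by
    ext m
    rw [mem_gr_quotient]
    constructor
    · rintro ⟨p, hp, rfl⟩
      obtain ⟨w, rfl⟩ := (mem_gr_zero_projectiveModule μ p).mp hp
      exact ⟨w, rfl⟩
    · rintro ⟨w, rfl⟩
      exact ⟨_, (mem_gr_zero_projectiveModule μ _).mpr ⟨w, rfl⟩, rfl⟩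
  rw [hrange]
  exact (Module.Finite.equiv_iff f.toLinearMap.quotKerEquivRange).symm

/-- In degree zero the truncation is V(μ) modulo the intersection of the submodules cut out by the
kernels K. Each of these has finite codimension, and at most one such submodule is proper, so the
intersection is that one or all of V(μ). -/
theorem g2_truncation_projectiveModule (μ : DominantWeight b) (Γ : Set (DominantWeight b × ℕ)) :
    G2 (truncation Γ (projectiveModule μ 0)) := by
  set P := projectiveModule μ 0 with hP
  have hg := P.isGraded_sInf (truncationKernels Γ P) fun _ hK ↦ hK.1
  refine ((isGradedGenerator_projectiveModule μ).quotient _ hg).g2 ?_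
  rw [finiteDimensional_gr_zero_iff]
  let N (K : LieSubmodule ℂ (AdExt 𝔤) P.carrier) (hK : P.IsGraded K) :
    LieSubmodule ℂ 𝔤 (SimpleModule μ) := ((P.quotientMap K hK).comp (toProjective μ)).ker
  have hN : ∀ K hK w, w ∈ N K hK ↔ toProjective μ w ∈ K := fun K hK w ↦ by
    rw [LieModuleHom.mem_ker]
    exact P.quotientMap_eq_zero K hK _
  have hmem : ∀ w, w ∈ N _ hg ↔ ∀ K ∈ truncationKernels Γ P, toProjective μ w ∈ K := by
    intro w
    rw [hN, ← SetLike.mem_coe, LieSubmodule.coe_sInf, Set.mem_iInter₂]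
    rfl
  change FiniteDimensional ℂ (SimpleModule μ ⧸ N _ hg)
  by_cases h : ∀ (K) (hK : K ∈ truncationKernels Γ P), N K hK.1 = ⊤
  · have htop : N _ hg = ⊤ := by
      refine eq_top_iff.mpr fun w _ ↦ (hmem w).mpr fun K hK ↦ ?_
      rw [← hN K hK.1, h K hK]
      exact LieSubmodule.mem_top w
    have hsub : Subsingleton (SimpleModule μ ⧸ N _ hg) := by
      rw [htop]
      exact Submodule.Quotient.subsingleton_iff.mpr rfl
    infer_instance
  · push Not at h
    obtain ⟨K₀, hK₀, hne⟩ := h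
    have hfd : ∀ (K) (hK : K ∈ truncationKernels Γ P),
        FiniteDimensional ℂ (SimpleModule μ ⧸ N K hK.1) := fun K hK ↦
      (finiteDimensional_gr_zero_iff μ K hK.1).mp (hK.2.1 0)
    have heq : N _ hg = N K₀ hK₀.1 := by
      apply le_antisymm
      · exact fun w hw ↦ (hN K₀ hK₀.1 w).mpr ((hmem w).mp hw K₀ hK₀)
      · intro w hw
        refine (hmem w).mpr fun K hK ↦ (hN K hK.1 w).mp ?_
        have h1 := hfd K hK
        have h2 := hfd K₀ hK₀
        exact SimpleModule.le_of_finiteDimensional_quotient μ _ _ hne hw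
    rw [heq]
    exact hfd K₀ hK₀

end Projective

/-! ### The pairing with a dominant weight -/

section Pairing

open LieAlgebra LieAlgebra.IsKilling LieModule

variable {𝔤 : Type u} [LieRing 𝔤] [LieAlgebra ℂ 𝔤] [FiniteDimensional ℂ 𝔤]
  [LieAlgebra.IsSimple ℂ 𝔤] {𝔥 : LieSubalgebra ℂ 𝔤} [𝔥.IsCartanSubalgebra]
  {b : (rootSystem 𝔥).Base}

/-- The real part of the pairing with a fixed linear form. -/
def rePairing (ξ : Module.Dual ℂ 𝔥) : Module.Dual ℂ 𝔥 →+ ℝ where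
  toFun k := (dualForm k ξ).re
  map_zero' := by rw [dualForm_eq, killingDual, map_zero, map_zero, Complex.zero_re]
  map_add' k l := by
    simp only [dualForm_eq, killingDual, map_add, Complex.add_re]

theorem rePairing_nonneg (ξ : DominantWeight b) {p : Module.Dual ℂ 𝔥} (hp : p ∈ posCone b) :
    0 ≤ rePairing ξ.1 p := by
  obtain ⟨r, hr, h⟩ := exists_apply_killingDual_nonneg ξ.2 hp
  change 0 ≤ (dualForm p ξ.1).re
  rwa [dualForm_eq, h, Complex.ofReal_re]

theorem exists_rootDual_eq_neg (α : 𝔥.root) : ∃ β : 𝔥.root, rootDual β = -rootDual α :=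
  ⟨(rootSystem 𝔥).reflectionPerm α α, by
    rw [rootDual, (rootSystem 𝔥).root_reflectionPerm, RootPairing.reflection_apply_self]⟩

-- Without roots 𝔤 would coincide with the abelian algebra 𝔥.
variable (𝔥) in
theorem nonempty_root : Nonempty 𝔥.root := by
  by_contra h
  rw [not_nonempty_iff] at h
  have hmem : ∀ x : 𝔤, x ∈ 𝔥 :=
    mem_of_cartan_of_rootSpace 𝔥.toSubmodule (fun y ↦ y.2) fun α ↦ h.elim α
  refine LieAlgebra.IsSimple.non_abelian (R := ℂ) (L := 𝔤) ⟨fun x y ↦ ?_⟩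
  have := trivial_lie_zero 𝔥 𝔥 ⟨x, hmem x⟩ ⟨y, hmem y⟩
  exact congrArg Subtype.val this

theorem exists_mem_maximalRoots (ξ : DominantWeight b) : ∃ β, β ∈ maximalRoots ξ := by
  have := nonempty_root 𝔥
  exact Finite.exists_max fun β : 𝔥.root ↦ rePairing ξ.1 (rootDual β)

/-- If the maximum were not positive, the negative of `β` would attain it too, and two opposite
roots would both be positive. -/
theorem rePairing_pos {ξ : DominantWeight b} (hξ : maximalRoots ξ ⊆ positiveRoots b)
    {β : 𝔥.root} (hβ : β ∈ maximalRoots ξ) : 0 < rePairing ξ.1 (rootDual β) := by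
  by_contra! hle
  obtain ⟨γ, hγ⟩ := exists_rootDual_eq_neg β
  have hγmax : γ ∈ maximalRoots ξ := by
    intro δ
    change rePairing ξ.1 (rootDual δ) ≤ rePairing ξ.1 (rootDual γ)
    rw [hγ, map_neg]
    have : rePairing ξ.1 (rootDual δ) ≤ rePairing ξ.1 (rootDual β) := hβ δ
    linarith
  have h0 := eq_zero_of_add_eq_zero_of_mem_posCone (b := b) (hξ hβ) (hξ hγmax)
    (show rootDual β + rootDual γ = 0 by rw [hγ]; exact add_neg_cancel _)
  exact (rootSystem 𝔥).ne_zero β h0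

/-- Subtracting roots of `maximalRoots ξ` lowers the pairing with `ξ` by their number. -/
theorem rePairing_sub_sum {ξ : DominantWeight b} {β : 𝔥.root} (hβ : β ∈ maximalRoots ξ)
    (k : Module.Dual ℂ 𝔥) {n : 𝔥.root → ℕ} (hn : ∀ γ ∉ maximalRoots ξ, n γ = 0) :
    rePairing ξ.1 (k - ∑ γ, n γ • (rootSystem 𝔥).root γ) =
      rePairing ξ.1 k - (∑ γ, n γ : ℕ) * rePairing ξ.1 (rootDual β) := by
  rw [map_sub, map_sum, Nat.cast_sum, Finset.sum_mul]
  congr 1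
  refine Finset.sum_congr rfl fun γ _ ↦ ?_
  rw [map_nsmul, nsmul_eq_mul]
  by_cases hγ : γ ∈ maximalRoots ξ
  · exact congrArg (((n γ : ℕ) : ℝ) * ·) (le_antisymm (hβ γ) (hγ β))
  · rw [hn γ hγ, Nat.cast_zero, zero_mul, zero_mul]

/-- All roots of Ψ have the same pairing with ξ, so the degree alone determines the pairing of a
weight in Γ. -/
theorem rePairing_of_mem_gammaSet {ξ lam ν : DominantWeight b} {s : ℕ} {β : 𝔥.root}
    (hβ : β ∈ maximalRoots ξ) (h : (ν, s) ∈ GammaSet lam (maximalRoots ξ)) :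
    rePairing ξ.1 ν.1 = rePairing ξ.1 lam.1 - s * rePairing ξ.1 (rootDual β) := by
  obtain ⟨n, hn, hν, hs⟩ := h
  change ν.1 = _ at hν
  change _ = s at hs
  rw [hν, ← hs]
  exact rePairing_sub_sum hβ lam.1 hn

theorem gammaSet_subset_shiftDown {lam μ : DominantWeight b} {Ψ : Set 𝔥.root} {r : ℕ}
    (hμ : (μ, r) ∈ GammaSet lam Ψ) : GammaSet μ Ψ ⊆ shiftDown r (GammaSet lam Ψ) := by
  rintro ⟨ν, s⟩ ⟨m, hm, hν, hs⟩
  obtain ⟨n, hn, hμ, hr⟩ := hμ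
  change μ.1 = _ at hμ
  change ν.1 = _ at hν
  change _ = s at hs
  change _ = r at hr
  refine ⟨m + n, fun β hβ ↦ by rw [Pi.add_apply, hm β hβ, hn β hβ], ?_, ?_⟩
  · change ν.1 = _
    simp only [Pi.add_apply, add_smul, Finset.sum_add_distrib]
    rw [hν, hμ]
    abel
  · change _ = s + r
    simp only [Pi.add_apply, Finset.sum_add_distrib]
    rw [hs, hr]

end Pairing

/-! ### Quotients of `P(μ, 0)` -/

section Main

open LieAlgebra LieAlgebra.IsKilling LieModule GradedLieMod

variable {𝔤 : Type u} [LieRing 𝔤] [LieAlgebra ℂ 𝔤] [FiniteDimensional ℂ 𝔤]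
  [LieAlgebra.IsSimple ℂ 𝔤] {𝔥 : LieSubalgebra ℂ 𝔤} [𝔥.IsCartanSubalgebra]
  {b : (rootSystem 𝔥).Base} {Q : GradedLieMod 𝔤}

theorem IsWeightVec.ad_lie {k : Module.Dual ℂ 𝔥} {m : Q.carrier} (hm : IsWeightVec k m)
    {γ : Module.Dual ℂ 𝔥} {x : 𝔤} (hx : x ∈ rootSpace 𝔥 (γ : 𝔥 → ℂ)) :
    IsWeightVec (k + γ) ⁅AdExt.ad x, m⁆ := by
  intro h
  have : ⁅(h : 𝔤), x⁆ = γ h • x := lie_eq_smul_of_mem_rootSpace hx h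
  rw [lie_ad_lie, this, hm h, map_smul, smul_lie, lie_smul, ← add_smul, add_comm]
  rfl

/-- The elements obtained from `v` by applying `s` root vectors of `𝔤_ad` for the negatives of the
roots in `Ψ`. -/
def adGenerators (v : Q.carrier) (Ψ : Set 𝔥.root) : ℕ → Set Q.carrier
  | 0 => {v}
  | s + 1 => {t | ∃ β ∈ Ψ, ∃ x ∈ rootSpace 𝔥 (-(β.1 : 𝔥 → ℂ)), ∃ a ∈ adGenerators v Ψ s,
      t = ⁅AdExt.ad x, a⁆}

theorem adGenerators_subset_gr {v : Q.carrier} (hv : v ∈ Q.gr 0) (Ψ : Set 𝔥.root) (s : ℕ) :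
    adGenerators v Ψ s ⊆ Q.gr s := by
  induction s with
  | zero => rintro _ rfl; exact hv
  | succ s ih =>
    rintro _ ⟨β, -, x, -, a, ha, rfl⟩
    exact Q.ad_lie_mem x s a (ih ha)

theorem exists_weight_of_mem_adGenerators {μ : Module.Dual ℂ 𝔥} {v : Q.carrier}
    (hv : IsWeightVec μ v) (Ψ : Set 𝔥.root) (s : ℕ) {a : Q.carrier}
    (ha : a ∈ adGenerators v Ψ s) : ∃ n : 𝔥.root → ℕ, (∀ β ∉ Ψ, n β = 0) ∧
      IsWeightVec (μ - ∑ β, n β • (rootSystem 𝔥).root β) a ∧ ∑ β, n β = s := by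
  classical
  induction s generalizing a with
  | zero =>
    obtain rfl : a = v := ha
    exact ⟨0, fun _ _ ↦ rfl, by simpa using hv, by simp⟩
  | succ s ih =>
    obtain ⟨β, hβ, x, hx, a, ha, rfl⟩ := ha
    obtain ⟨n, hn, hw, hs⟩ := ih ha
    refine ⟨n + Pi.single β 1, fun γ hγ ↦ ?_, ?_, ?_⟩
    · rw [Pi.add_apply, hn γ hγ, Pi.single_eq_of_ne (by rintro rfl; exact hγ hβ), add_zero]
    · have h1 := hw.ad_lie (γ := -rootDual β) hx
      have h2 : ∑ γ, (Pi.single β 1 : 𝔥.root → ℕ) γ • (rootSystem 𝔥).root γ = rootDual β := by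
        rw [Finset.sum_eq_single β]
        · rw [Pi.single_eq_same, one_smul]
        · intro γ _ hγ
          rw [Pi.single_eq_of_ne hγ, zero_smul]
        · exact fun h ↦ absurd (Finset.mem_univ β) h
      simp only [Pi.add_apply, add_smul, Finset.sum_add_distrib]
      rw [h2]
      convert h1 using 1
      abel
    · simp only [Pi.add_apply, Finset.sum_add_distrib]
      rw [hs, Finset.sum_pi_single']
      simp

/-- An element of `𝔤_ad` of large weight kills a weight vector of extremal weight. -/
theorem ad_lie_eq_zero {ξ lam : DominantWeight b} {r : ℕ}
    (hQ : G2Gamma (shiftDown r (GammaSet lam (maximalRoots ξ))) Q) {β : 𝔥.root}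
    (hβ : β ∈ maximalRoots ξ) {s : ℕ} {a : Q.carrier} (ha : a ∈ Q.gr s) {k : Module.Dual ℂ 𝔥}
    (hk : IsWeightVec k a)
    (hkξ : rePairing ξ.1 k = rePairing ξ.1 lam.1 - (s + r : ℕ) * rePairing ξ.1 (rootDual β))
    {γ : Module.Dual ℂ 𝔥} (hγ : -rePairing ξ.1 (rootDual β) < rePairing ξ.1 γ) {x : 𝔤}
    (hx : x ∈ rootSpace 𝔥 (γ : 𝔥 → ℂ)) : ⁅AdExt.ad x, a⁆ = 0 := by
  by_contra h0
  obtain ⟨hfd, hQ⟩ := g2Gamma_iff.mp hQ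
  have := hfd (s + 1)
  let t : Q.gr (s + 1) := ⟨⁅AdExt.ad x, a⁆, Q.ad_lie_mem x s a ha⟩
  have ht : IsWeightVec (k + γ) t := fun h ↦ Subtype.ext (hk.ad_lie hx h)
  obtain ⟨p, hp, w, hw0, hw⟩ := ht.exists_isSingular (fun h ↦ h0 (congrArg Subtype.val h)) b
  -- `ν` is the weight of a singular vector above the supposedly nonzero vector. Membership in Γ
  -- fixes its pairing with ξ, but `k + γ` already exceeds that value, and `p ∈ Q⁺` cannot lower it
  -- since ξ is dominant.
  let ν : DominantWeight b := ⟨k + γ + p, fun i hi ↦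
    (hw.exists_apply_coroot_eq hw0 hi).imp fun n hn ↦ hn.1⟩
  have hν : (ν, s + 1 + r) ∈ GammaSet lam (maximalRoots ξ) :=
    hQ ν (s + 1) w w.2 (fun h ↦ hw0 (Subtype.ext h)) (isSingular_gr_iff.mpr hw)
  have h1 := rePairing_of_mem_gammaSet hβ hν
  have h2 := rePairing_nonneg ξ hp
  change rePairing ξ.1 (k + γ + p) = _ at h1
  rw [map_add, map_add, hkξ] at h1
  push_cast at h1
  linarith

variable {v : Q.carrier}

theorem IsGradedGenerator.negGenerates_gr_zero (h : IsGradedGenerator Q v)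
    {μ : Module.Dual ℂ 𝔥} (hv : IsSingular b μ v) :
    NegGenerates b {(⟨v, h.mem⟩ : Q.gr 0)} := by
  refine IsSingular.negGenerates (isSingular_gr_iff.mp hv) fun N hN ↦ ?_
  rw [eq_top_iff]
  rintro ⟨m, hm⟩ -
  have := h.gr_zero_le (N.toSubmodule.map (Q.gr 0).subtype) ⟨_, hN, rfl⟩ ?_ hm
  · obtain ⟨m', hm', rfl⟩ := this
    exact hm'
  · rintro x _ ⟨m, hm, rfl⟩
    exact ⟨⁅x, m⁆, N.lie_mem hm, rfl⟩

/-- Induction on the degree, for all `N` at once. The vectors that all of 𝔤_ad maps into `N` form a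
subspace stable under lowering, since [y, ad x] = ad [y, x]. It contains the words of length s, on
which only the roots in -Ψ act nontrivially and produce words of length s + 1. Hence it contains
Q[s], and 𝔤_ad Q[s] spans Q[s + 1]. -/
theorem IsGradedGenerator.gr_le_of_adGenerators_subset (h : IsGradedGenerator Q v)
    {μ : Module.Dual ℂ 𝔥} (hv : IsSingular b μ v) {Ψ : Set 𝔥.root}
    (h0 : ∀ s, ∀ a ∈ adGenerators v Ψ s, ∀ x : 𝔥, ⁅AdExt.ad (x : 𝔤), a⁆ = 0)
    (hΨ : ∀ s, ∀ a ∈ adGenerators v Ψ s, ∀ α : 𝔥.root,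
      (∃ β ∈ Ψ, (α.1 : 𝔥 → ℂ) = -β.1) ∨ ∀ x ∈ rootSpace 𝔥 (α.1 : 𝔥 → ℂ), ⁅AdExt.ad x, a⁆ = 0)
    (s : ℕ) (N : Submodule ℂ Q.carrier) (hA : adGenerators v Ψ s ⊆ N)
    (hN : ∀ i ∈ b.support, ∀ y ∈ rootSpace 𝔥 (-(i.1 : 𝔥 → ℂ)), ∀ m ∈ N, ⁅y, m⁆ ∈ N) :
    Q.gr s ≤ N := by
  induction s generalizing N with
  | zero =>
    have htop := h.negGenerates_gr_zero hv (N.comap (Q.gr 0).subtype)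
      (Set.singleton_subset_iff.mpr (hA rfl)) fun i hi y hy m hm ↦ hN i hi y hy _ hm
    intro m hm
    have : (⟨m, hm⟩ : Q.gr 0) ∈ N.comap (Q.gr 0).subtype := htop ▸ trivial
    exact this
  | succ s ih =>
    let N' : Submodule ℂ Q.carrier :=
      { carrier := {m | ∀ x : 𝔤, ⁅AdExt.ad x, m⁆ ∈ N}
        add_mem' := fun hm hn x ↦ by rw [lie_add]; exact add_mem (hm x) (hn x)
        zero_mem' := fun x ↦ by rw [lie_zero]; exact zero_mem N
        smul_mem' := fun c m hm x ↦ by rw [lie_smul]; exact N.smul_mem c (hm x) }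
    refine h.gr_succ_le s N fun x m hm ↦ ih N' (fun a ha ↦ ?_) (fun i hi y hy m hm x ↦ ?_) hm x
    · let S : Submodule ℂ 𝔤 :=
        { carrier := {x | ⁅AdExt.ad x, a⁆ ∈ N}
          add_mem' := fun {x y} hx hy ↦ by
            change ⁅AdExt.ad (x + y), a⁆ ∈ N
            rw [map_add, add_lie]; exact add_mem hx hy
          zero_mem' := by
            change ⁅AdExt.ad (0 : 𝔤), a⁆ ∈ N
            rw [map_zero, zero_lie]; exact zero_mem N
          smul_mem' := fun c x hx ↦ by
            change ⁅AdExt.ad (c • x), a⁆ ∈ N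
            rw [map_smul, smul_lie]; exact N.smul_mem c hx }
      refine mem_of_cartan_of_rootSpace (𝔥 := 𝔥) S (fun y ↦ ?_) fun α y hy ↦ ?_
      · change ⁅AdExt.ad (y : 𝔤), a⁆ ∈ N
        rw [h0 s a ha y]; exact zero_mem N
      · change ⁅AdExt.ad y, a⁆ ∈ N
        rcases hΨ s a ha α with ⟨β, hβ, hαβ⟩ | hα
        · exact hA ⟨β, hβ, y, hαβ ▸ hy, a, ha, rfl⟩
        · rw [hα y hy]; exact zero_mem N
    · have h1 := lie_ad_lie Q y x m
      have h2 : ⁅AdExt.ad x, ⁅y, m⁆⁆ = ⁅y, ⁅AdExt.ad x, m⁆⁆ - ⁅AdExt.ad ⁅y, x⁆, m⁆ := by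
        rw [h1, add_sub_cancel_left]
      rw [h2]
      exact sub_mem (hN i hi y hy _ (hm x)) (hm _)

theorem IsGradedGenerator.g2Gamma_gammaSet (h : IsGradedGenerator Q v) {ξ lam μ : DominantWeight b}
    (hv : IsSingular b μ.1 v) (hξ : maximalRoots ξ ⊆ positiveRoots b) {r : ℕ}
    (hμ : (μ, r) ∈ GammaSet lam (maximalRoots ξ))
    (hQ : G2Gamma (shiftDown r (GammaSet lam (maximalRoots ξ))) Q) :
    G2Gamma (GammaSet μ (maximalRoots ξ)) Q := by
  obtain ⟨β, hβ⟩ := exists_mem_maximalRoots ξ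
  have hpos := rePairing_pos hξ hβ
  -- The words of length s have the extremal pairing (λ, ξ) - (s + r)M, because (μ, r) ∈ Γ and each
  -- factor lowers the pairing by M.
  have hzero : ∀ s, ∀ a ∈ adGenerators v (maximalRoots ξ) s, ∀ γ : Module.Dual ℂ 𝔥,
      -rePairing ξ.1 (rootDual β) < rePairing ξ.1 γ → ∀ x ∈ rootSpace 𝔥 (γ : 𝔥 → ℂ),
      ⁅AdExt.ad x, a⁆ = 0 := by
    intro s a ha γ hγ x hx
    obtain ⟨n, hn, hk, hs⟩ := exists_weight_of_mem_adGenerators hv.1 _ s ha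
    refine ad_lie_eq_zero hQ hβ (adGenerators_subset_gr h.mem _ s ha) hk ?_ hγ hx
    rw [rePairing_sub_sum hβ _ hn, rePairing_of_mem_gammaSet hβ hμ, hs]
    push_cast
    ring
  -- The Cartan subalgebra has weight 0, and it annihilates the words because -M < 0; this is where
  -- positivity of Ψ enters.
  have hgr := h.gr_le_of_adGenerators_subset hv (Ψ := maximalRoots ξ)
    (fun s a ha x ↦ hzero s a ha 0 (by rw [map_zero]; linarith) x ?_)
    (fun s a ha α ↦ ?_)
  · obtain ⟨hfd, -⟩ := hQ
    refine g2Gamma_iff.mpr ⟨hfd, fun ν s w hw hw0 hs ↦ ?_⟩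
    have := hfd s
    have hgen : NegGenerates b {a : Q.gr s | (a : Q.carrier) ∈ adGenerators v (maximalRoots ξ) s} := by
      intro N hA hN
      rw [eq_top_iff]
      rintro ⟨m, hm⟩ -
      obtain ⟨m', hm', rfl⟩ := hgr s (N.map (Q.gr s).subtype)
        (fun a ha ↦ ⟨⟨a, adGenerators_subset_gr h.mem _ s ha⟩, hA ha, rfl⟩)
        (by
          rintro i hi y hy _ ⟨m, hm, rfl⟩
          exact ⟨⁅y, m⁆, hN i hi y hy m hm, rfl⟩) hm
      exact hm'
    have hwt : ∀ a : Q.gr s, (a : Q.carrier) ∈ adGenerators v (maximalRoots ξ) s →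
        ∃ n : 𝔥.root → ℕ, (∀ β ∉ maximalRoots ξ, n β = 0) ∧
          IsWeightVec (μ.1 - ∑ β, n β • (rootSystem 𝔥).root β) a ∧ ∑ β, n β = s := by
      intro a ha
      obtain ⟨n, hn, hk, hs⟩ := exists_weight_of_mem_adGenerators hv.1 _ s ha
      exact ⟨n, hn, fun t ↦ Subtype.ext (hk t), hs⟩
    obtain ⟨a, ha, ha0, haw⟩ := hgen.exists_weight_eq
      (fun a ha ↦ (hwt a ha).imp' (fun n ↦ _) fun n hn ↦ hn.2.1)
      (isSingular_gr_iff.mp hs : IsSingular b ν.1 (⟨w, hw⟩ : Q.gr s))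
      (fun h ↦ hw0 (congrArg Subtype.val h))
    obtain ⟨n, hn, hk, hns⟩ := hwt a ha
    exact ⟨n, hn, haw.eq_of_ne_zero hk ha0, hns⟩
  · change (x : 𝔤) ∈ rootSpace 𝔥 (0 : 𝔥 → ℂ)
    rw [← LieSubmodule.mem_toSubmodule, rootSpace_zero_eq]
    exact x.2
  -- Either the root pairs with ξ above -M and its root vectors annihilate the words, or its
  -- negative attains the maximum and hence lies in Ψ.
  · rcases lt_or_ge (-rePairing ξ.1 (rootDual β)) (rePairing ξ.1 (rootDual α)) with hα | hα
    · exact Or.inr fun x hx ↦ hzero s a ha (rootDual α) hα x hx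
    · left
      obtain ⟨γ, hγ⟩ := exists_rootDual_eq_neg α
      refine ⟨γ, fun δ ↦ ?_, ?_⟩
      · change rePairing ξ.1 (rootDual δ) ≤ rePairing ξ.1 (rootDual γ)
        have : rePairing ξ.1 (rootDual δ) ≤ rePairing ξ.1 (rootDual β) := hβ δ
        rw [hγ, map_neg]
        linarith
      · funext t
        have : γ.1 t = -α.1 t := DFunLike.congr_fun hγ t
        rw [Pi.neg_apply, this, neg_neg]

theorem g2Gamma_mono {Γ Γ' : Set (DominantWeight b × ℕ)} (h : Γ ⊆ Γ') (hQ : G2Gamma Γ Q) :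
    G2Gamma Γ' Q :=
  ⟨hQ.1, fun p hp ↦ h (hQ.2 p hp)⟩

/-- Both truncations divide by the intersection of the same family of graded submodules. -/
theorem truncation_shiftDown_projectiveModule {ξ lam μ : DominantWeight b}
    (hξ : maximalRoots ξ ⊆ positiveRoots b) {r : ℕ}
    (hμ : (μ, r) ∈ GammaSet lam (maximalRoots ξ)) :
    truncation (shiftDown r (GammaSet lam (maximalRoots ξ))) (projectiveModule μ 0) =
      truncation (GammaSet μ (maximalRoots ξ)) (projectiveModule μ 0) := by
  refine quotient_congr _ (congrArg sInf (Set.ext fun K ↦ exists_congr fun hK ↦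
    ⟨fun hQ ↦ ?_, g2Gamma_mono (gammaSet_subset_shiftDown hμ)⟩)) _ _
  exact ((isGradedGenerator_projectiveModule μ).quotient K hK).g2Gamma_gammaSet
    (((SimpleModule.isSingular_mk_one μ).map (toProjective μ)).map
      ((projectiveModule μ 0).quotientMap K hK)) hξ hμ hQ

end Main

end

theorem mainTheorem4 (𝔤 : Type u) [LieRing 𝔤] [LieAlgebra ℂ 𝔤] [FiniteDimensional ℂ 𝔤]
    [LieAlgebra.IsSimple ℂ 𝔤] (𝔥 : LieSubalgebra ℂ 𝔤) [𝔥.IsCartanSubalgebra]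
    (b : (LieAlgebra.IsKilling.rootSystem 𝔥).Base)
    (Ψ : Set 𝔥.root) (hpos : Ψ ⊆ positiveRoots b)
    (hmax : ∃ ξ : DominantWeight b, Ψ = maximalRoots ξ)
    (lam μ : DominantWeight b) (r : ℕ) (hμ : (μ, r) ∈ GammaSet lam Ψ) :
    G2Gamma (GammaSet lam Ψ) (truncation (GammaSet lam Ψ) (projectiveModule μ r)) ∧
    G2Gamma (GammaSet μ Ψ) (truncation (GammaSet μ Ψ) (projectiveModule μ 0)) ∧
    Nonempty ((GradedLieMod.shift r).obj (truncation (GammaSet μ Ψ) (projectiveModule μ 0)) ≅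
      truncation (GammaSet lam Ψ) (projectiveModule μ r)) := by
  obtain ⟨ξ, rfl⟩ := hmax
  have h : truncation (GammaSet lam (maximalRoots ξ)) (projectiveModule μ r) =
      GradedLieMod.shiftObj r
        (truncation (GammaSet μ (maximalRoots ξ)) (projectiveModule μ 0)) := by
    rw [projectiveModule_eq_shiftObj μ r, truncation_shiftObj,
      truncation_shiftDown_projectiveModule hpos hμ]
  have h2 := g2Gamma_truncation _ _ (g2_truncation_projectiveModule μ (GammaSet μ (maximalRoots ξ)))
  refine ⟨?_, h2, ⟨eqToIso h.symm⟩⟩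
  -- The first claim is the second one shifted by `r`, together with the inclusion of Γ(μ, Ψ) in the
  -- lowered set.
  rw [h, g2Gamma_shiftObj]
  exact g2Gamma_mono (gammaSet_subset_shiftDown hμ) h2
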